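/- Let $d\ge 2$ be an integer and let $\mathbb F$ be a field. For a positive integer $n$ and $p\in[0,1]$ let $X_d(n,p)$ be the random simplicial complex on $n$ vertices that has a full $(d-1)$-dimensional skeleton and whose $d$-dimensional faces are chosen independently, each of the $\binom{n}{d+1}$ candidates with probability $p$. The equation $$-\ln(1-\beta)=\frac{(d+1)\beta}{d+1-d\beta}$$ has a unique root $\beta=\beta_d$ in the open interval $(0,1)$; put $c_d^*=-\ln(1-\beta_d)/\beta_d^{\,d}$. A $(d-1)$-face of a $d$-dimensional complex is free if exactly one $d$-face contains it, and an elementary collapse at a free $(d-1)$-face removes it together with that $d$-face. In a phase of collapsing one lists all $(d-1)$-faces that are free at the beginning of the phase, scans the list in an arbitrary order, performs the elementary collapse at each listed face that is still free when it is reached, and skips the others. Let $R_k(X)$ be a complex obtained from $X$ by $k$ consecutive phases, and let $$s_k(X)=f_d(R_k(X))-f_{d-1}(R_k(X))+\zeta_k(X),$$ where $f_i$ is the number of $i$-dimensional faces and $\zeta_k(X)$ is the number of zero rows of the matrix of the boundary operator $\partial_d$ of $R_k(X)$ over $\mathbb F$ (rows indexed by the $(d-1)$-faces, columns by the $d$-faces).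 Let $c>c_d^*$. Then there is a constant $k_0$, not depending on $n$, such that for every fixed $k_*\ge k_0$, as $n\to\infty$, a complex $X\sim X_d(n,\tfrac cn)$ satisfies $$\Pr\bigl[\,s_{k_*}(X)>0\text{ for every choice of the scanning orders}\,\bigr]=1-o(1).$$ Moreover, for every complex $X$ on finitely many vertices $1,\dots,n$ that has a full $(d-1)$-skeleton and dimension at most $d$, and for every $k\ge 0$, if $s_k(X)>0$ for some choice of the scanning orders, then $H_d(X;\mathbb F)\neq 0$. Consequently $\Pr[H_d(X;\mathbb F)\neq 0]=1-o(1)$ for $X\sim X_d(n,\tfrac cn)$. -/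

import Mathlib

open Filter Topology

namespace RandomComplex

section Complexes

variable {V : Type*}

/-- The faces of `K` with exactly `m` vertices, i.e. the faces of dimension `m - 1`.
As faces are nonempty, there are none for `m = 0`. -/
def cells (K : PreAbstractSimplicialComplex V) (m : ℕ) : Set (Finset V) :=
  {s | s ∈ K.faces ∧ s.card = m}

noncomputable instance instFintypeCells [Finite V] (K : PreAbstractSimplicialComplex V) (m : ℕ) :
    Fintype (cells K m) :=
  Fintype.ofFinite _

/-- `f_i(K)`, the number of `i`-dimensional faces. -/
noncomputable def faceCount (K : PreAbstractSimplicialComplex V) (i : ℕ) : ℕ :=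
  (cells K (i + 1)).ncard

/-- The degree of a `(d-1)`-face `τ`: the number of `d`-faces of `K` that contain it. -/
noncomputable def degree (d : ℕ) (K : PreAbstractSimplicialComplex V) (τ : Finset V) : ℕ :=
  {σ | σ ∈ cells K (d + 1) ∧ τ ⊆ σ}.ncard

/-- `τ` is a free `(d-1)`-face of `K`: it lies in exactly one `d`-face. -/
def IsFree (d : ℕ) (K : PreAbstractSimplicialComplex V) (τ : Finset V) : Prop :=
  τ ∈ cells K d ∧ degree d K τ = 1

/-- Remove from `K` the face `τ` and all faces that contain it. -/
def deleteStar (K : PreAbstractSimplicialComplex V) (τ : Finset V) :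
    PreAbstractSimplicialComplex V where
  faces := {s | s ∈ K.faces ∧ ¬ τ ⊆ s}
  isRelLowerSet_faces := fun _ hs =>
    ⟨(K.isRelLowerSet_faces hs.1).1, fun _ ht hne =>
      ⟨(K.isRelLowerSet_faces hs.1).2 ht hne, fun h => hs.2 (h.trans ht)⟩⟩

/-- In a complex of dimension at most `d`, deleting the star of a free `(d-1)`-face `τ` removes
exactly `τ` and the unique `d`-face `σ` containing it, so it is an elementary collapse. -/
theorem deleteStar_faces_of_isFree {d : ℕ} {K : PreAbstractSimplicialComplex V} {τ : Finset V}
    (hdim : ∀ s ∈ K.faces, s.card ≤ d + 1) (h : IsFree d K τ) :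
    ∃ σ, {σ' | σ' ∈ cells K (d + 1) ∧ τ ⊆ σ'} = {σ} ∧
      (deleteStar K τ).faces = K.faces \ {τ, σ} := by
  obtain ⟨⟨hτ, hc⟩, h1⟩ := h
  obtain ⟨σ, hσ⟩ := Set.ncard_eq_one.mp h1
  refine ⟨σ, hσ, ?_⟩
  have hmem : ∀ s, (s ∈ cells K (d + 1) ∧ τ ⊆ s) ↔ s = σ := fun s => by
    have := Set.ext_iff.mp hσ s
    simpa using this
  ext s
  simp only [deleteStar, Set.mem_ofPred_eq, Set.mem_sdiff, Set.mem_insert_iff,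
    Set.mem_singleton_iff, not_or]
  constructor
  · rintro ⟨hs, hn⟩
    refine ⟨hs, ?_, ?_⟩
    · rintro rfl
      exact hn subset_rfl
    · rintro rfl
      exact hn ((hmem s).mpr rfl).2
  · rintro ⟨hs, hne, hnσ⟩
    refine ⟨hs, fun hsub => ?_⟩
    have hlt := Finset.card_lt_card (hsub.ssubset_of_ne (Ne.symm hne))
    have hle := hdim s hs
    exact hnσ ((hmem s).mp ⟨⟨hs, by omega⟩, hsub⟩)

open Classical in
/-- One step of the scan: if `τ` is free at the moment it is reached, perform the elementary
collapse at `τ`; otherwise skip `τ`. -/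
noncomputable def collapseStep (d : ℕ) (K : PreAbstractSimplicialComplex V) (τ : Finset V) :
    PreAbstractSimplicialComplex V :=
  if IsFree d K τ then deleteStar K τ else K

/-- `L` arises from `K` by one phase of collapsing: all `(d-1)`-faces that are free in `K` are
listed in some order and scanned one after the other. -/
def IsPhase (d : ℕ) (K L : PreAbstractSimplicialComplex V) : Prop :=
  ∃ l : List (Finset V), l.Nodup ∧ (∀ τ, τ ∈ l ↔ IsFree d K τ) ∧ L = l.foldl (collapseStep d) K

/-- `L` is a possible outcome of `k` consecutive phases of collapsing starting from `K`. -/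
def IsResidue (d : ℕ) : ℕ → PreAbstractSimplicialComplex V → PreAbstractSimplicialComplex V → Prop
  | 0, K, L => L = K
  | k + 1, K, L => ∃ M, IsResidue d k K M ∧ IsPhase d M L

/-- The collapsing process can always be carried out. -/
theorem exists_isResidue [Finite V] (d k : ℕ) (K : PreAbstractSimplicialComplex V) :
    ∃ L, IsResidue d k K L := by
  induction k with
  | zero => exact ⟨K, rfl⟩
  | succ k ih =>
    obtain ⟨M, hM⟩ := ih
    have hfin : {τ | IsFree d M τ}.Finite := Set.toFinite _
    exact ⟨_, M, hM, hfin.toFinset.toList, Finset.nodup_toList _, fun τ => by simp, rfl⟩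

variable (F : Type*) [Field F]

/-- The matrix of the boundary operator from `m`-dimensional chains (columns: faces with `m + 1`
vertices) to `(m-1)`-dimensional chains (rows: faces with `m` vertices). Every face is oriented by
the order of its vertices `v₀ < ⋯ < v_m`; the entry at `(σ \ {v_i}, σ)` is `(-1)^i`, all other
entries are `0`. -/
def boundaryMatrix [LinearOrder V] (K : PreAbstractSimplicialComplex V) (m : ℕ) :
    Matrix (cells K m) (cells K (m + 1)) F :=
  fun τ σ => ∑ v ∈ (σ : Finset V),
    if (σ : Finset V).erase v = τ then (-1) ^ ((σ : Finset V).filter (· < v)).card else 0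

/-- The boundary operator `∂_m : C_m(K; F) → C_{m-1}(K; F)`. -/
noncomputable def boundary [Finite V] [LinearOrder V] (K : PreAbstractSimplicialComplex V) (m : ℕ) :
    (cells K (m + 1) → F) →ₗ[F] (cells K m → F) :=
  (boundaryMatrix F K m).mulVecLin

/-- Simplicial homology `H_i(K; F) = ker ∂_i / im ∂_{i+1}`. -/
abbrev Homology [Finite V] [LinearOrder V] (K : PreAbstractSimplicialComplex V) (i : ℕ) : Type _ :=
  LinearMap.ker (boundary F K i) ⧸
    (LinearMap.range (boundary F K (i + 1))).submoduleOf (LinearMap.ker (boundary F K i))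

/-- The number of zero rows of a matrix. -/
noncomputable def zeroRows {R C : Type*} (M : Matrix R C F) : ℕ :=
  {r | M r = 0}.ncard

/-- `f_d(R) - f_{d-1}(R) + ζ(R)`, where `ζ(R)` is the number of zero rows of the `d`-th boundary
matrix of `R`. The `(d-1)`-faces are the ones with `d` vertices. -/
noncomputable def surplus [LinearOrder V] (d : ℕ) (R : PreAbstractSimplicialComplex V) : ℤ :=
  (faceCount R d : ℤ) - ((cells R d).ncard : ℤ) + (zeroRows F (boundaryMatrix F R d) : ℤ)

end Complexes

/-- The complex on the vertex set `Fin n` with full `(d-1)`-skeleton whose `d`-faces are the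
members of `S` with `d + 1` elements. -/
def complexOf (d n : ℕ) (S : Set (Finset (Fin n))) : PreAbstractSimplicialComplex (Fin n) where
  faces := {s | s.Nonempty ∧ (s.card ≤ d ∨ s.card = d + 1 ∧ s ∈ S)}
  isRelLowerSet_faces := fun s hs => ⟨hs.1, fun t ht hne => ⟨hne, by
    have hle := Finset.card_le_card ht
    rcases hs.2 with h | ⟨h, hS⟩
    · exact Or.inl (hle.trans h)
    · rcases Nat.lt_or_ge t.card (d + 1) with hlt | hge
      · exact Or.inl (Nat.lt_succ_iff.mp hlt)
      · have hts : t = s := Finset.eq_of_subset_of_card_le ht (h.le.trans hge)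
        subst hts
        exact Or.inr ⟨h, hS⟩⟩⟩

/-- The probability that `X ∼ X_d(n, p)` has the property `P`: each set of `d + 1` vertices is a
`d`-face independently with probability `p` (`p` is truncated to `[0, 1]`, which for `p = c / n`
with `c > 0` has no effect once `n ≥ c`). -/
noncomputable def prob (d n : ℕ) (p : ℝ) (P : PreAbstractSimplicialComplex (Fin n) → Prop) : ℝ :=
  (ProbabilityTheory.setBernoulli {σ : Finset (Fin n) | σ.card = d + 1}
    (Set.projIcc (0 : ℝ) 1 zero_le_one p)).real {S | P (complexOf d n S)}

/-- `β ∈ (0, 1)` solves `-ln(1 - β) = (d + 1) β / (d + 1 - d β)`. -/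
def IsCriticalRoot (d : ℕ) (β : ℝ) : Prop :=
  0 < β ∧ β < 1 ∧ -Real.log (1 - β) = ((d + 1 : ℝ) * β) / ((d + 1 : ℝ) - d * β)

/-- The number `-ln(1 - β) / β ^ d`, which is `c*_d` when `β = β_d`. -/
noncomputable def criticalConst (d : ℕ) (β : ℝ) : ℝ :=
  -Real.log (1 - β) / β ^ d

end RandomComplex

/-! Combinatorial half. The scanning order does not affect the `d`-faces: a phase deletes exactly
those that contain a `(d-1)`-face free at its start (`IsPhase.cells_eq`), so the survivors of `k`
phases form `core d H k`, with `H` the set of `d`-faces. The zero rows cancel the `(d-1)`-faces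
outside every survivor, and the surplus becomes the number of survivors minus the size of their
shadow (`surplus_eq`). If this is positive, the boundary restricted to the survivors has more
columns than nonzero rows, hence a nonzero kernel; as there are no `(d+1)`-faces, a nonzero cycle is
a nonzero homology class.

Local estimate. Whether a `d`-face survives is described by non-backtracking messages from
`(d-1)`-faces to `d`-faces. Call a `d`-face above `τ` alive if none of its other facets sends it a
message. If `τ` has at least two alive faces above it, these are precisely the survivors above it
(`aliveAbove_subset_core`). Counting incidences then bounds the surplus from below by a sum over all
`τ` of functions of a bounded neighbourhood (`core_surplus_ge`).

Concentration. The neighbourhoods of two disjoint `(d-1)`-faces are jointly close to two independent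
random trees. For trees without repeated labels the true probability is at least the tree weight,
and trees with repetitions have total weight O(p), so the two laws are within O(p)
(`exists_pair_bound`). A second moment computation and Chebyshev's inequality follow
(`exists_concentration_bound`).

Limit. In the random tree the number of alive faces at the root is binomial with mean tending to c
x_k^d, where x_0 = 1 and x_{k+1} = 1 - exp(-c x_k^d). Up to a truncation error, the surplus per
`(d-1)`-face is at least E[X; X ≥ 2]/(d+1) - P[Y ≥ 2], with X, Y Poisson of consecutive means; this
is `density`. The x_k decrease to a fixed point b, and c > c* forces b > β. At the fixed point
`density` equals `gap d b / (d+1)`, and `gap` is positive between β and 1, so `density` is positive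
for all large k (`eventually_density_pos`). -/

namespace RandomComplex

/-! ### Collapsing phases as pruning, and the linear algebra of the surplus -/

section Pruning

variable {V : Type*}

/-- The members of `H` none of whose `d`-subsets is contained in exactly one member of `H`. -/
def prune (d : ℕ) (H : Set (Finset V)) : Set (Finset V) :=
  {σ | σ ∈ H ∧ ∀ τ : Finset V, τ.card = d → τ ⊆ σ → ∃ σ' ∈ H, σ' ≠ σ ∧ τ ⊆ σ'}

/-- The `d`-faces that survive `k` phases of collapsing. -/
def core (d : ℕ) (H : Set (Finset V)) : ℕ → Set (Finset V)
  | 0 => H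
  | k + 1 => prune d (core d H k)

/-- The sets of size `d` contained in a member of `H`. -/
def shadow (d : ℕ) (H : Set (Finset V)) : Set (Finset V) :=
  {τ | τ.card = d ∧ ∃ σ ∈ H, τ ⊆ σ}

theorem core_succ_subset (d : ℕ) (H : Set (Finset V)) (k : ℕ) :
    core d H (k + 1) ⊆ core d H k := fun _ h => h.1

theorem core_antitone (d : ℕ) (H : Set (Finset V)) : Antitone (core d H) :=
  antitone_nat_of_succ_le (core_succ_subset d H)

theorem core_subset (d : ℕ) (H : Set (Finset V)) (k : ℕ) : core d H k ⊆ H :=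
  core_antitone d H (Nat.zero_le k)

theorem cells_deleteStar (K : PreAbstractSimplicialComplex V) (τ : Finset V) (m : ℕ) :
    cells (deleteStar K τ) m = {σ | σ ∈ cells K m ∧ ¬ τ ⊆ σ} := by
  ext σ
  simp only [cells, deleteStar, Set.mem_ofPred_eq]
  tauto

theorem mem_cells_of_subset {K : PreAbstractSimplicialComplex V} {d : ℕ} (hd : 0 < d)
    {τ σ : Finset V} (hτ : τ.card = d) (hσ : σ ∈ cells K (d + 1)) (h : τ ⊆ σ) : τ ∈ cells K d :=
  ⟨(K.isRelLowerSet_faces hσ.1).2 h (Finset.card_pos.mp (by omega)), hτ⟩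

theorem exists_ne_of_degree_ne_one {d : ℕ} {K : PreAbstractSimplicialComplex V} {τ σ : Finset V}
    (hσ : σ ∈ cells K (d + 1)) (h : τ ⊆ σ) :
    degree d K τ ≠ 1 ↔ ∃ σ' ∈ cells K (d + 1), σ' ≠ σ ∧ τ ⊆ σ' := by
  unfold degree
  rw [not_iff_comm, Set.ncard_eq_one]
  constructor
  · intro hn
    refine ⟨σ, Set.eq_singleton_iff_unique_mem.mpr ⟨⟨hσ, h⟩, fun x hx => ?_⟩⟩
    by_contra hne
    exact hn ⟨x, hx.1, hne, hx.2⟩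
  · rintro ⟨a, ha⟩ ⟨σ', h1, h2, h3⟩
    have e1 : σ ∈ ({a} : Set (Finset V)) := ha ▸ ⟨hσ, h⟩
    have e2 : σ' ∈ ({a} : Set (Finset V)) := ha ▸ ⟨h1, h3⟩
    exact h2 (e2.trans e1.symm)

/-- At most one vertex of `σ` can be erased to give `τ`, so the sum has at most one nonzero term, a
sign, which survives in every characteristic. This makes the zero rows independent of the field. -/
theorem boundaryMatrix_ne_zero_iff (F : Type*) [Field F] [LinearOrder V] (K : PreAbstractSimplicialComplex V) (m : ℕ)
    (τ : cells K m) (σ : cells K (m + 1)) :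
    boundaryMatrix F K m τ σ ≠ 0 ↔ (τ : Finset V) ⊆ σ := by
  constructor
  · intro h
    obtain ⟨v, -, hv⟩ := Finset.exists_ne_zero_of_sum_ne_zero h
    have : (σ : Finset V).erase v = τ := by
      by_contra hne
      simp [hne] at hv
    rw [← this]
    exact Finset.erase_subset _ _
  · intro h
    have hcard : ((σ : Finset V) \ τ).card = 1 := by
      rw [Finset.card_sdiff_of_subset h, σ.2.2, τ.2.2]; omega
    obtain ⟨v, hv⟩ := Finset.card_eq_one.mp hcard
    have hvm : v ∈ (σ : Finset V) ∧ v ∉ (τ : Finset V) := by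
      have : v ∈ (σ : Finset V) \ τ := by rw [hv]; simp
      simpa using this
    have key : ∀ w ∈ (σ : Finset V), (σ : Finset V).erase w = τ ↔ w = v := by
      intro w hw
      constructor
      · intro e
        have : w ∈ (σ : Finset V) \ τ := by
          rw [← e]; simp [hw]
        rw [hv] at this
        simpa using this
      · rintro rfl
        refine (Finset.eq_of_subset_of_card_le ?_ ?_).symm
        · exact fun x hx => Finset.mem_erase.mpr ⟨fun e => hvm.2 (e ▸ hx), h hx⟩
        · rw [Finset.card_erase_of_mem hw, σ.2.2, τ.2.2]; omega
    unfold boundaryMatrix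
    rw [Finset.sum_eq_single v]
    · rw [if_pos ((key v hvm.1).mpr rfl)]
      exact pow_ne_zero _ (by simp)
    · intro w hw hne
      rw [if_neg (fun e => hne ((key w hw).mp e))]
    · exact fun h => absurd hvm.1 h

variable [Finite V]

/-- With degree 1 the step deletes the one `d`-face above `τ`; with degree 0 it is skipped and there
is nothing to delete. Both outcomes have the same formula, which is what makes the scan order
harmless. -/
theorem cells_collapseStep {d : ℕ} (hd : 0 < d) {K : PreAbstractSimplicialComplex V} {τ : Finset V}
    (hτ : τ.card = d) (h : degree d K τ ≤ 1) :
    cells (collapseStep d K τ) (d + 1) = {σ | σ ∈ cells K (d + 1) ∧ ¬ τ ⊆ σ} := by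
  unfold collapseStep
  split_ifs with hf
  · exact cells_deleteStar K τ _
  · ext σ
    simp only [Set.mem_ofPred_eq, iff_self_and]
    intro hσ hsub
    refine hf ⟨mem_cells_of_subset hd hτ hσ hsub, le_antisymm h ?_⟩
    exact (Set.ncard_pos (Set.toFinite _)).mpr ⟨σ, hσ, hsub⟩

theorem degree_mono {d : ℕ} {K L : PreAbstractSimplicialComplex V}
    (h : cells K (d + 1) ⊆ cells L (d + 1)) (τ : Finset V) : degree d K τ ≤ degree d L τ :=
  Set.ncard_le_ncard (fun _ hσ => ⟨h hσ.1, hσ.2⟩) (Set.toFinite _)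

theorem cells_foldl_collapseStep {d : ℕ} (hd : 0 < d) (l : List (Finset V))
    (K : PreAbstractSimplicialComplex V) (hl : ∀ τ ∈ l, τ.card = d ∧ degree d K τ ≤ 1) :
    cells (l.foldl (collapseStep d) K) (d + 1) =
      {σ | σ ∈ cells K (d + 1) ∧ ∀ τ ∈ l, ¬ τ ⊆ σ} := by
  induction l generalizing K with
  | nil => simp
  | cons τ l ih =>
    have hτ := hl τ (by simp)
    have hc := cells_collapseStep hd hτ.1 hτ.2
    rw [List.foldl_cons, ih, hc]
    · ext σ
      simp only [Set.mem_ofPred_eq, List.mem_cons, forall_eq_or_imp]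
      tauto
    · intro τ' h'
      have h2 := hl τ' (by simp [h'])
      refine ⟨h2.1, (degree_mono ?_ τ').trans h2.2⟩
      rw [hc]
      exact fun _ h => h.1

/-- Every listed face starts with degree 1 and degrees only drop during the scan, so each listed
face ends up below no `d`-face, whether it was collapsed or skipped. -/
theorem IsPhase.cells_eq {d : ℕ} (hd : 0 < d) {K L : PreAbstractSimplicialComplex V}
    (h : IsPhase d K L) : cells L (d + 1) = prune d (cells K (d + 1)) := by
  obtain ⟨l, -, hl, rfl⟩ := h
  rw [cells_foldl_collapseStep hd l K fun τ hτ =>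
    ⟨((hl τ).mp hτ).1.2, ((hl τ).mp hτ).2.le⟩]
  ext σ
  simp only [prune, Set.mem_ofPred_eq, and_congr_right_iff]
  intro hσ
  constructor
  · intro hn τ hτ hsub
    rw [← exists_ne_of_degree_ne_one hσ hsub]
    exact fun h1 => hn τ ((hl τ).mpr ⟨mem_cells_of_subset hd hτ hσ hsub, h1⟩) hsub
  · intro hn τ hτ hsub
    have hf := (hl τ).mp hτ
    exact (exists_ne_of_degree_ne_one hσ hsub).mpr (hn τ hf.1.2 hsub) hf.2

theorem IsResidue.cells_eq {d : ℕ} (hd : 0 < d) {K : PreAbstractSimplicialComplex V} {k : ℕ}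
    {R : PreAbstractSimplicialComplex V} (h : IsResidue d k K R) :
    cells R (d + 1) = core d (cells K (d + 1)) k := by
  induction k generalizing R with
  | zero => rw [show R = K from h]; rfl
  | succ k ih =>
    obtain ⟨M, hM, hp⟩ := h
    rw [hp.cells_eq hd, ih hM, core]

variable (F : Type*) [Field F]

/-- A row vanishes exactly when its face lies in no `d`-face, so removing the zero rows from the
`(d-1)`-faces leaves the shadow. -/
theorem surplus_eq [LinearOrder V] {d : ℕ} (hd : 0 < d) (R : PreAbstractSimplicialComplex V) :
    surplus F d R =
      ((cells R (d + 1)).ncard : ℤ) - ((shadow d (cells R (d + 1))).ncard : ℤ) := by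
  have hz : zeroRows F (boundaryMatrix F R d) =
      (cells R d \ shadow d (cells R (d + 1))).ncard := by
    unfold zeroRows
    rw [← Set.ncard_image_of_injective _ Subtype.val_injective]
    congr 1
    ext τ
    simp only [Set.mem_image, Set.mem_ofPred_eq, Subtype.exists, exists_and_right, exists_eq_right,
      Set.mem_sdiff]
    constructor
    · rintro ⟨hτ, h0⟩
      refine ⟨hτ, ?_⟩
      rintro ⟨-, σ, hσ, hsub⟩
      exact (boundaryMatrix_ne_zero_iff F R d ⟨τ, hτ⟩ ⟨σ, hσ⟩).mpr hsub (congrFun h0 _)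
    · rintro ⟨hτ, hn⟩
      refine ⟨hτ, funext fun σ => ?_⟩
      by_contra h0
      exact hn ⟨hτ.2, σ, σ.2, (boundaryMatrix_ne_zero_iff F R d ⟨τ, hτ⟩ σ).mp h0⟩
  have hsub : shadow d (cells R (d + 1)) ⊆ cells R d := fun τ hτ => by
    obtain ⟨h1, σ, h2, h3⟩ := hτ
    exact mem_cells_of_subset hd h1 h2 h3
  have := Set.ncard_sdiff_add_ncard_of_subset hsub (Set.toFinite _)
  unfold surplus faceCount
  rw [hz]
  omega

/-- A family of `d`-faces with a shadow smaller than the family carries a nonzero cycle. -/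
theorem nontrivial_homology_of_ncard_shadow_lt [LinearOrder V] {d : ℕ}
    {K : PreAbstractSimplicialComplex V} (hK : cells K (d + 2) = ∅) {H : Set (Finset V)}
    (hH : H ⊆ cells K (d + 1)) (h : (shadow d H).ncard < H.ncard) :
    Nontrivial (Homology F K d) := by
  classical
  have : Fintype H := Fintype.ofFinite _
  have : Fintype (shadow d H) := Fintype.ofFinite _
  let ext : (H → F) →ₗ[F] (cells K (d + 1) → F) :=
    { toFun := fun x σ => if hσ : (σ : Finset V) ∈ H then x ⟨σ, hσ⟩ else 0
      map_add' := fun x y => by ext σ; by_cases hσ : (σ : Finset V) ∈ H <;> simp [hσ]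
      map_smul' := fun a x => by ext σ; by_cases hσ : (σ : Finset V) ∈ H <;> simp [hσ] }
  let res : (cells K d → F) →ₗ[F] (shadow d H → F) :=
    { toFun := fun y τ => if hτ : (τ : Finset V) ∈ cells K d then y ⟨τ, hτ⟩ else 0
      map_add' := fun x y => by ext σ; by_cases hσ : (σ : Finset V) ∈ cells K d <;> simp [hσ]
      map_smul' := fun a x => by ext σ; by_cases hσ : (σ : Finset V) ∈ cells K d <;> simp [hσ] }
  -- Chains supported on `H` are only tested on the shadow: more unknowns than equations. The
  -- remaining rows vanish on such chains automatically.
  have hker : LinearMap.ker (res ∘ₗ boundary F K d ∘ₗ ext) ≠ ⊥ := by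
    apply LinearMap.ker_ne_bot_of_finrank_lt
    rw [Module.finrank_fintype_fun_eq_card, Module.finrank_fintype_fun_eq_card,
      ← Nat.card_eq_fintype_card, ← Nat.card_eq_fintype_card]
    exact h
  obtain ⟨x, hx, hx0⟩ := (Submodule.ne_bot_iff _).mp hker
  have hb : boundary F K d (ext x) = 0 := by
    funext τ
    by_cases hτ : (τ : Finset V) ∈ shadow d H
    · have := congrFun (LinearMap.mem_ker.mp hx) ⟨τ, hτ⟩
      simpa [res] using this
    · simp only [boundary, Matrix.mulVecLin_apply, Matrix.mulVec, dotProduct, Pi.zero_apply]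
      refine Finset.sum_eq_zero fun σ _ => ?_
      by_cases hσ : (σ : Finset V) ∈ H
      · have : boundaryMatrix F K d τ σ = 0 := by
          by_contra hne
          exact hτ ⟨τ.2.2, σ, hσ, (boundaryMatrix_ne_zero_iff F K d τ σ).mp hne⟩
        rw [this, zero_mul]
      · simp [ext, hσ]
  have he : ext x ≠ 0 := by
    intro h0
    apply hx0
    funext σ
    have := congrFun h0 ⟨σ, hH σ.2⟩
    simpa [ext] using this
  -- Without `(d+1)`-faces there are no boundaries, so the cycle found cannot become zero in
  -- homology.
  have hempty : IsEmpty (cells K (d + 1 + 1)) := by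
    rw [show d + 1 + 1 = d + 2 from rfl, hK]; infer_instance
  have hrange : LinearMap.range (boundary F K (d + 1)) = ⊥ := by
    rw [LinearMap.range_eq_bot]
    ext x
    exact hempty.elim (by assumption)
  refine Submodule.Quotient.nontrivial_iff.mpr fun htop => ?_
  have hm : (⟨ext x, hb⟩ : LinearMap.ker (boundary F K d)) ∈
      (LinearMap.range (boundary F K (d + 1))).submoduleOf (LinearMap.ker (boundary F K d)) := by
    rw [htop]; trivial
  have hm' : ext x ∈ LinearMap.range (boundary F K (d + 1)) := hm
  rw [hrange, Submodule.mem_bot] at hm'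
  exact he hm'

end Pruning

theorem cells_complexOf_top (d n : ℕ) (S : Set (Finset (Fin n))) :
    cells (complexOf d n S) (d + 1) = {σ | σ ∈ S ∧ σ.card = d + 1} := by
  ext σ
  simp only [cells, complexOf, Set.mem_ofPred_eq]
  constructor
  · rintro ⟨⟨-, h | h⟩, h2⟩
    · omega
    · exact ⟨h.2, h2⟩
  · rintro ⟨h1, h2⟩
    exact ⟨⟨Finset.card_pos.mp (by omega), Or.inr ⟨h2, h1⟩⟩, h2⟩

theorem cells_complexOf_eq_empty (d n : ℕ) (S : Set (Finset (Fin n))) :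
    cells (complexOf d n S) (d + 2) = ∅ := by
  ext σ
  simp only [cells, complexOf, Set.mem_ofPred_eq, Set.mem_empty_iff_false, iff_false]
  rintro ⟨⟨-, h | h⟩, h2⟩ <;> omega

theorem surplus_residue (F : Type*) [Field F] {d n k : ℕ} (hd : 0 < d) {S : Set (Finset (Fin n))}
    {R : PreAbstractSimplicialComplex (Fin n)} (h : IsResidue d k (complexOf d n S) R) :
    surplus F d R = ((core d {σ | σ ∈ S ∧ σ.card = d + 1} k).ncard : ℤ) -
      ((shadow d (core d {σ | σ ∈ S ∧ σ.card = d + 1} k)).ncard : ℤ) := by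
  rw [surplus_eq F hd, h.cells_eq hd, cells_complexOf_top]

theorem nontrivial_homology_of_surplus_pos (F : Type*) [Field F] {d n k : ℕ} (hd : 0 < d)
    {S : Set (Finset (Fin n))} {R : PreAbstractSimplicialComplex (Fin n)}
    (h : IsResidue d k (complexOf d n S) R) (hs : 0 < surplus F d R) :
    Nontrivial (Homology F (complexOf d n S) d) := by
  rw [surplus_residue F hd h] at hs
  refine nontrivial_homology_of_ncard_shadow_lt F (cells_complexOf_eq_empty d n S)
    (H := core d {σ | σ ∈ S ∧ σ.card = d + 1} k) ?_ (by omega)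
  rw [cells_complexOf_top]
  exact core_subset _ _ _

end RandomComplex

namespace RandomComplex

/-! ### The critical root, the survival recursion and positivity of the limiting density -/

section CriticalRoot

/-- The function whose sign decides on which side of the critical root a point lies. -/
noncomputable def gap (d : ℕ) (x : ℝ) : ℝ :=
  -Real.log (1 - x) * ((d + 1 : ℝ) - d * x) - (d + 1) * x

noncomputable def gapDeriv (d : ℕ) (x : ℝ) : ℝ := x / (1 - x) + d * Real.log (1 - x)

theorem hasDerivAt_gap (d : ℕ) {x : ℝ} (hx : x < 1) : HasDerivAt (gap d) (gapDeriv d x) x := by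
  have h1 : 1 - x ≠ 0 := by linarith
  have hl : HasDerivAt (fun x : ℝ => Real.log (1 - x)) (-1 / (1 - x)) x :=
    ((hasDerivAt_id x).const_sub 1).log h1
  have hm : HasDerivAt (fun x : ℝ => (d + 1 : ℝ) - d * x) (-(d * 1)) x :=
    ((hasDerivAt_id x).const_mul (d : ℝ)).const_sub _
  have := (hl.neg.mul hm).sub ((hasDerivAt_id x).const_mul (d + 1 : ℝ))
  refine this.congr_deriv ?_
  unfold gapDeriv
  simp only [Pi.neg_apply]
  field_simp
  ring

theorem hasDerivAt_gapDeriv (d : ℕ) {x : ℝ} (hx : x < 1) :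
    HasDerivAt (gapDeriv d) ((1 - d * (1 - x)) / (1 - x) ^ 2) x := by
  have h1 : 1 - x ≠ 0 := by linarith
  have hs : HasDerivAt (fun x : ℝ => 1 - x) (-1) x := (hasDerivAt_id x).const_sub 1
  have := ((hasDerivAt_id x).div hs h1).add ((hs.log h1).const_mul (d : ℝ))
  refine this.congr_deriv ?_
  simp only [id]
  field_simp
  ring

theorem gapDeriv_zero (d : ℕ) : gapDeriv d 0 = 0 := by simp [gapDeriv]

theorem gap_zero (d : ℕ) : gap d 0 = 0 := by simp [gap]

/-- The second derivative of `gap` has the sign of 1 - d(1 - x), which changes at 1 - 1/d. Before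
that point `gap` is concave, and it starts at 0 with slope 0. -/
theorem gap_neg_of_le {d : ℕ} (hd : 2 ≤ d) {x : ℝ} (hx0 : 0 < x) (hx : x ≤ 1 - 1 / d) :
    gap d x < 0 := by
  have hd0 : (0 : ℝ) < d := by positivity
  have hlt : (1 : ℝ) - 1 / d < 1 := by have : (0 : ℝ) < 1 / d := by positivity
                                       linarith
  have hanti : StrictAntiOn (gapDeriv d) (Set.Icc 0 (1 - 1 / d)) := by
    refine strictAntiOn_of_deriv_neg (convex_Icc _ _) ?_ ?_
    · exact fun y hy =>
        (hasDerivAt_gapDeriv d (hy.2.trans_lt hlt)).continuousAt.continuousWithinAt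
    · intro y hy
      rw [interior_Icc] at hy
      have hy1 : y < 1 := hy.2.trans hlt
      rw [(hasDerivAt_gapDeriv d hy1).deriv]
      refine div_neg_of_neg_of_pos ?_ (by have : 0 < 1 - y := by linarith
                                          positivity)
      have h2 : 1 / (d : ℝ) < 1 - y := by linarith [hy.2]
      have := mul_lt_mul_of_pos_left h2 hd0
      rw [mul_one_div_cancel hd0.ne'] at this
      linarith
  have hanti2 : StrictAntiOn (gap d) (Set.Icc 0 (1 - 1 / d)) := by
    refine strictAntiOn_of_deriv_neg (convex_Icc _ _) ?_ ?_
    · exact fun y hy => (hasDerivAt_gap d (hy.2.trans_lt hlt)).continuousAt.continuousWithinAt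
    · intro y hy
      rw [interior_Icc] at hy
      rw [(hasDerivAt_gap d (hy.2.trans hlt)).deriv, ← gapDeriv_zero d]
      exact hanti ⟨le_rfl, (hy.1.trans hy.2).le⟩ ⟨hy.1.le, hy.2.le⟩ hy.1
  rw [← gap_zero d]
  exact hanti2 ⟨le_rfl, hx0.le.trans hx⟩ ⟨hx0.le, hx⟩ hx0

theorem convexOn_gap {d : ℕ} (hd : 2 ≤ d) : ConvexOn ℝ (Set.Ico (1 - 1 / (d : ℝ)) 1) (gap d) := by
  have hd0 : (0 : ℝ) < d := by positivity
  refine MonotoneOn.convexOn_of_deriv (convex_Ico _ _) ?_ ?_ ?_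
  · exact fun y hy => (hasDerivAt_gap d hy.2).continuousAt.continuousWithinAt
  · intro y hy
    rw [interior_Ico] at hy
    exact (hasDerivAt_gap d hy.2).differentiableAt.differentiableWithinAt
  · rw [interior_Ico]
    have hmono : MonotoneOn (gapDeriv d) (Set.Ioo (1 - 1 / (d : ℝ)) 1) := by
      refine monotoneOn_of_deriv_nonneg (convex_Ioo _ _) ?_ ?_ ?_
      · exact fun y hy => (hasDerivAt_gapDeriv d hy.2).continuousAt.continuousWithinAt
      · intro y hy
        rw [interior_Ioo] at hy
        exact (hasDerivAt_gapDeriv d hy.2).differentiableAt.differentiableWithinAt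
      · intro y hy
        rw [interior_Ioo] at hy
        rw [(hasDerivAt_gapDeriv d hy.2).deriv]
        refine div_nonneg ?_ (sq_nonneg _)
        have h2 : 1 - y < 1 / (d : ℝ) := by linarith [hy.1]
        have := mul_lt_mul_of_pos_left h2 hd0
        rw [mul_one_div_cancel hd0.ne'] at this
        linarith
    exact hmono.congr fun y hy => (hasDerivAt_gap d hy.2).deriv.symm

theorem isCriticalRoot_iff {d : ℕ} {x : ℝ} :
    IsCriticalRoot d x ↔ 0 < x ∧ x < 1 ∧ gap d x = 0 := by
  unfold IsCriticalRoot gap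
  refine and_congr_right fun h0 => and_congr_right fun h1 => ?_
  have : (0 : ℝ) < (d + 1 : ℝ) - d * x := by
    have : (d : ℝ) * x ≤ d * 1 := by gcongr
    linarith
  rw [eq_div_iff this.ne', sub_eq_zero]

/-- The root lies beyond 1 - 1/d, in the convex range. From 1 - 1/d to the root `gap` climbs from a
negative value to 0, and by convexity the later slope is at least as large. -/
theorem gap_pos_of_root_lt {d : ℕ} (hd : 2 ≤ d) {x y : ℝ} (hx : IsCriticalRoot d x) (hxy : x < y)
    (hy : y < 1) : 0 < gap d y := by
  rw [isCriticalRoot_iff] at hx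
  have hd1 : (2 : ℝ) ≤ d := by exact_mod_cast hd
  have ha0 : (0 : ℝ) < 1 - 1 / d := by
    have : 1 / (d : ℝ) < 1 := by rw [div_lt_one] <;> linarith
    linarith
  have ha1 : (1 : ℝ) - 1 / d < 1 := by
    have : (0 : ℝ) < 1 / d := by positivity
    linarith
  have ha := gap_neg_of_le hd ha0 le_rfl
  have hax : 1 - 1 / (d : ℝ) < x := by
    by_contra hle
    have := gap_neg_of_le hd hx.1 (not_lt.mp hle)
    linarith [hx.2.2]
  by_contra hneg
  have hc := (convexOn_gap hd).slope_mono_adjacent (x := 1 - 1 / (d : ℝ)) (y := x) (z := y)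
    ⟨le_rfl, ha1⟩ ⟨by linarith, hy⟩ hax hxy
  rw [hx.2.2] at hc
  have h1 : 0 < (0 - gap d (1 - 1 / (d : ℝ))) / (x - (1 - 1 / d)) :=
    div_pos (by linarith) (by linarith)
  have h2 : (gap d y - 0) / (y - x) ≤ 0 :=
    div_nonpos_of_nonpos_of_nonneg (by linarith) (by linarith)
  linarith

theorem existsUnique_isCriticalRoot {d : ℕ} (hd : 2 ≤ d) : ∃! β : ℝ, IsCriticalRoot d β := by
  have hd1 : (2 : ℝ) ≤ d := by exact_mod_cast hd
  have ha0 : (0 : ℝ) < 1 - 1 / d := by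
    have : 1 / (d : ℝ) < 1 := by rw [div_lt_one] <;> linarith
    linarith
  have hE : Real.exp (-(d + 1 : ℝ)) < 1 / d := by
    rw [Real.exp_neg, ← one_div]
    apply one_div_lt_one_div_of_lt (by linarith)
    linarith [Real.add_one_le_exp (d + 1 : ℝ)]
  -- Here log(1 - b) = -(d+1), which makes `gap d b` equal to (d+1)²(1 - b); the bound `hE` puts b
  -- to the right of 1 - 1/d.
  set b : ℝ := 1 - Real.exp (-(d + 1 : ℝ)) with hb
  have hb1 : b < 1 := by have := Real.exp_pos (-(d + 1 : ℝ)); linarith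
  have hab : 1 - 1 / (d : ℝ) ≤ b := by linarith
  have hbpos : 0 ≤ gap d b := by
    unfold gap
    have : 1 - b = Real.exp (-(d + 1 : ℝ)) := by rw [hb]; ring
    rw [this, Real.log_exp]
    have h3 : (d : ℝ) * b ≤ d * 1 := by gcongr
    nlinarith
  have hcont : ContinuousOn (gap d) (Set.Icc (1 - 1 / (d : ℝ)) b) := fun y hy =>
    (hasDerivAt_gap d (hy.2.trans_lt hb1)).continuousAt.continuousWithinAt
  obtain ⟨β, hβ, h0⟩ := intermediate_value_Icc hab hcont
    ⟨(gap_neg_of_le hd ha0 le_rfl).le, hbpos⟩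
  have hroot : IsCriticalRoot d β :=
    isCriticalRoot_iff.mpr ⟨ha0.trans_le hβ.1, hβ.2.trans_lt hb1, h0⟩
  refine ⟨β, hroot, fun γ hγ => ?_⟩
  rcases lt_trichotomy γ β with h | h | h
  · have := gap_pos_of_root_lt hd hγ h hroot.2.1
    linarith
  · exact h
  · have := gap_pos_of_root_lt hd hroot h hγ.2.1
    linarith [(isCriticalRoot_iff.mp hγ).2.2]

theorem criticalConst_pos {d : ℕ} {β : ℝ} (h : IsCriticalRoot d β) : 0 < criticalConst d β := by
  have h1 := h.1
  have h2 := h.2.1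
  refine div_pos ?_ (by positivity)
  have := Real.log_neg (x := 1 - β) (by linarith) (by linarith)
  linarith

/-- The probability that, in the limit, a `(d-1)`-face is not collapsed from below within `k`
phases. -/
noncomputable def survival (d : ℕ) (c : ℝ) : ℕ → ℝ
  | 0 => 1
  | k + 1 => 1 - Real.exp (-(c * survival d c k ^ d))

theorem survival_antitone_nonneg {d : ℕ} {c : ℝ} (hc : 0 < c) (k : ℕ) :
    0 ≤ survival d c k ∧ survival d c (k + 1) ≤ survival d c k := by
  induction k with
  | zero =>
    refine ⟨zero_le_one, ?_⟩
    simp only [survival]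
    have := Real.exp_pos (-(c * 1 ^ d))
    linarith
  | succ k ih =>
    constructor
    · simp only [survival]
      have : Real.exp (-(c * survival d c k ^ d)) ≤ 1 := by
        rw [Real.exp_le_one_iff]
        have := ih.1
        have : 0 ≤ c * survival d c k ^ d := by positivity
        linarith
      linarith
    · have h1 : 0 ≤ survival d c (k + 1) := by
        simp only [survival]
        have : Real.exp (-(c * survival d c k ^ d)) ≤ 1 := by
          rw [Real.exp_le_one_iff]
          have := ih.1
          have : 0 ≤ c * survival d c k ^ d := by positivity
          linarith
        linarith
      have h2 : survival d c (k + 1) ^ d ≤ survival d c k ^ d := pow_le_pow_left₀ h1 ih.2 d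
      have h3 : c * survival d c (k + 1) ^ d ≤ c * survival d c k ^ d := by gcongr
      exact sub_le_sub_left (Real.exp_le_exp.mpr (neg_le_neg h3)) 1

/-- For the critical constant the map x ↦ 1 - exp(-c x^d) fixes β; a larger c pushes its values on
[β, ∞) strictly above β. Hence the iteration from 1 never falls below β, and its limit is not β. -/
theorem root_le_survival {d : ℕ} {c β : ℝ} (h : IsCriticalRoot d β)
    (hc : criticalConst d β < c) {x : ℝ} (hx : β ≤ x) : β < 1 - Real.exp (-(c * x ^ d)) := by
  have h0 := h.1
  have h1 := h.2.1
  have hc0 := (criticalConst_pos h).trans hc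
  have hlog : -Real.log (1 - β) < c * β ^ d := by
    rwa [criticalConst, div_lt_iff₀ (by positivity)] at hc
  have h2 : c * β ^ d ≤ c * x ^ d := by gcongr
  have h3 : Real.exp (-(c * x ^ d)) < Real.exp (Real.log (1 - β)) :=
    Real.exp_lt_exp.mpr (by linarith)
  rw [Real.exp_log (by linarith)] at h3
  linarith

/-- The limiting density of the surplus after `k` phases, for a Poisson variable of parameter
`l' = c * survival d c k ^ d` and `l = c * survival d c (k - 1) ^ d`. -/
noncomputable def density (d : ℕ) (l l' : ℝ) : ℝ :=
  (l' - l' * Real.exp (-l')) / (d + 1) - (1 - Real.exp (-l) - l * Real.exp (-l))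

theorem tendsto_density {d : ℕ} {u v : ℕ → ℝ} {l l' : ℝ} (hu : Tendsto u atTop (𝓝 l))
    (hv : Tendsto v atTop (𝓝 l')) :
    Tendsto (fun k => density d (u k) (v k)) atTop (𝓝 (density d l l')) := by
  have hco : Continuous fun x : ℝ × ℝ => density d x.1 x.2 := by
    unfold density
    fun_prop
  exact (hco.tendsto (l, l')).comp (hu.prodMk_nhds hv)

/-- The survival probabilities decrease to a fixed point b, necessarily in (β, 1), and `density` is
continuous, so its sign at b decides. -/
theorem eventually_density_pos {d : ℕ} (hd : 2 ≤ d) {c β : ℝ} (h : IsCriticalRoot d β)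
    (hc : criticalConst d β < c) :
    ∀ᶠ k in atTop, 0 < density d (c * survival d c k ^ d) (c * survival d c (k + 1) ^ d) := by
  have hc0 := (criticalConst_pos h).trans hc
  have hanti : Antitone (survival d c) :=
    antitone_nat_of_succ_le fun k => (survival_antitone_nonneg hc0 k).2
  have hbdd : BddBelow (Set.range (survival d c)) :=
    ⟨0, by rintro _ ⟨k, rfl⟩; exact (survival_antitone_nonneg hc0 k).1⟩
  obtain ⟨b, hb⟩ : ∃ b, Tendsto (survival d c) atTop (𝓝 b) := ⟨_, tendsto_atTop_ciInf hanti hbdd⟩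
  have hge : ∀ k, β ≤ survival d c k := by
    intro k
    induction k with
    | zero => exact h.2.1.le
    | succ k ih => exact (root_le_survival h hc ih).le
  have hbβ : β ≤ b := ge_of_tendsto' hb hge
  have hfix : b = 1 - Real.exp (-(c * b ^ d)) := by
    have h1 : Tendsto (fun k => survival d c (k + 1)) atTop (𝓝 b) :=
      hb.comp (tendsto_add_atTop_nat 1)
    have h2 : Tendsto (fun k => survival d c (k + 1)) atTop (𝓝 (1 - Real.exp (-(c * b ^ d)))) := by
      simp only [survival]
      have hco : Continuous fun x : ℝ => 1 - Real.exp (-(c * x ^ d)) := by fun_prop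
      exact (hco.tendsto b).comp hb
    exact tendsto_nhds_unique h1 h2
  have hlt : β < b := by
    have := root_le_survival h hc hbβ
    rwa [← hfix] at this
  have hb1 : b < 1 := by
    rw [hfix]
    have := Real.exp_pos (-(c * b ^ d))
    linarith
  have hgap := gap_pos_of_root_lt hd h hlt hb1
  have hl : Real.log (1 - b) = -(c * b ^ d) := by
    rw [show 1 - b = Real.exp (-(c * b ^ d)) by linarith, Real.log_exp]
  -- With l = c b^d the fixed point equation reads exp(-l) = 1 - b, and (d+1) times the density
  -- simplifies to l(d + 1 - d b) - (d+1) b, which is `gap d b`.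
  have hpos : 0 < density d (c * b ^ d) (c * b ^ d) := by
    unfold density
    rw [show Real.exp (-(c * b ^ d)) = 1 - b by linarith]
    unfold gap at hgap
    rw [hl] at hgap
    have hd' : (0 : ℝ) < d + 1 := by positivity
    rw [div_sub' hd'.ne']
    refine div_pos ?_ hd'
    linarith
  have ht : Tendsto (fun k => density d (c * survival d c k ^ d) (c * survival d c (k + 1) ^ d))
      atTop (𝓝 (density d (c * b ^ d) (c * b ^ d))) := by
    have h1 := (hb.pow d).const_mul c
    exact tendsto_density h1 (h1.comp (tendsto_add_atTop_nat 1))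
  exact ht.eventually_const_lt hpos

end CriticalRoot

end RandomComplex

namespace RandomComplex

/-! ### Non-backtracking messages and their relation to the pruned families -/

section Messages

variable {V : Type*}

/-- `message d H j τ σ`: within `j` phases `τ` becomes a face of no member of `H` other than `σ`,
so that it can collapse `σ`. The recursion never turns back. -/
def message (d : ℕ) (H : Set (Finset V)) : ℕ → Finset V → Finset V → Prop
  | 0, _, _ => False
  | j + 1, τ, σ => ∀ σ' ∈ H, τ ⊆ σ' → σ' ≠ σ →
      ∃ τ' : Finset V, τ'.card = d ∧ τ' ⊆ σ' ∧ τ' ≠ τ ∧ message d H j τ' σ'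

theorem message_succ {d : ℕ} {H : Set (Finset V)} {j : ℕ} {τ σ : Finset V}
    (h : message d H j τ σ) : message d H (j + 1) τ σ := by
  induction j generalizing τ σ with
  | zero => exact h.elim
  | succ j ih =>
    intro σ' h1 h2 h3
    obtain ⟨τ', a, b, c, e⟩ := h σ' h1 h2 h3
    exact ⟨τ', a, b, c, ih e⟩

theorem message_mono {d : ℕ} {H : Set (Finset V)} {j k : ℕ} (hjk : j ≤ k) {τ σ : Finset V}
    (h : message d H j τ σ) : message d H k τ σ := by
  induction hjk with
  | refl => exact h
  | step _ ih => exact message_succ ih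

/-- Any other `σ'` above `τ` was pruned at some stage `l + 1 ≤ i`, because one of its facets `τ'`
then lay in no other face of `core d H l`. By strong induction `τ'` sends its message to `σ'` in
time. -/
theorem message_of_unique {d : ℕ} {H : Set (Finset V)} (i : ℕ) {τ σ : Finset V}
    (hσ : σ ∈ core d H i) (hτσ : τ ⊆ σ) (hu : ∀ σ' ∈ core d H i, τ ⊆ σ' → σ' = σ) :
    message d H (i + 1) τ σ := by
  induction i using Nat.strong_induction_on generalizing τ σ with
  | _ i ih =>
    intro σ' hσ' hsub hne
    have hex : ∃ l, σ' ∉ core d H l := ⟨i, fun h => hne (hu σ' h hsub)⟩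
    classical
    have hspec := Nat.find_spec hex
    have hle : Nat.find hex ≤ i := Nat.find_min' hex fun h => hne (hu σ' h hsub)
    obtain ⟨l, hl⟩ : ∃ l, Nat.find hex = l + 1 := by
      refine Nat.exists_eq_succ_of_ne_zero fun h0 => ?_
      rw [h0] at hspec
      exact hspec hσ'
    have hin : σ' ∈ core d H l := by
      by_contra hn
      have := Nat.find_min' hex hn
      omega
    rw [hl] at hspec hle
    have : ∃ τ' : Finset V, τ'.card = d ∧ τ' ⊆ σ' ∧ ∀ ρ ∈ core d H l, τ' ⊆ ρ → ρ = σ' := by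
      by_contra hno
      push Not at hno
      refine hspec ⟨hin, fun τ' h1 h2 => ?_⟩
      obtain ⟨ρ, h3, h4, h5⟩ := hno τ' h1 h2
      exact ⟨ρ, h3, h5, h4⟩
    obtain ⟨τ', h1, h2, h3⟩ := this
    refine ⟨τ', h1, h2, ?_, message_mono hle (ih l (by omega) hin h2 h3)⟩
    -- The facet responsible is not `τ` itself: at stage `l` the face `σ` was still present above
    -- `τ`, so `τ` lay in two faces.
    rintro rfl
    exact hne (h3 σ (core_antitone d H (by omega : l ≤ i) hσ) hτσ).symm

/-- If `σ` survived stage `j + 1`, then `τ` would lie in another face surviving stage `j`; but the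
message requires that face to receive a message of level `j`, so by induction it is gone. -/
theorem not_mem_core_of_message {d : ℕ} {H : Set (Finset V)} {j : ℕ} {τ σ : Finset V}
    (hτ : τ.card = d) (hτσ : τ ⊆ σ) (h : message d H j τ σ) : σ ∉ core d H j := by
  induction j generalizing τ σ with
  | zero => exact h.elim
  | succ j ih =>
    rintro ⟨-, h2⟩
    obtain ⟨σ', h3, h4, h5⟩ := h2 τ hτ hτσ
    obtain ⟨τ', a, b, -, e⟩ := h σ' (core_antitone d H (Nat.zero_le j) h3) h5 h4
    exact ih a b e h3

theorem exists_message_of_not_mem_core {d : ℕ} {H : Set (Finset V)} {j : ℕ} {σ : Finset V}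
    (hσ : σ ∈ H) (h : σ ∉ core d H j) :
    ∃ τ : Finset V, τ.card = d ∧ τ ⊆ σ ∧ message d H j τ σ := by
  induction j with
  | zero => exact absurd hσ h
  | succ j ih =>
    by_cases hj : σ ∈ core d H j
    · by_contra hno
      push Not at hno
      refine h ⟨hj, fun τ h1 h2 => ?_⟩
      by_contra hno2
      push Not at hno2
      refine hno τ h1 h2 (message_of_unique j hj h2 fun σ' h3 h4 => ?_)
      by_contra hne
      exact hno2 σ' h3 hne h4
    · obtain ⟨τ, a, b, e⟩ := ih hj
      exact ⟨τ, a, b, message_succ e⟩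

/-- The members of `H` above `τ` that receive no message from their other faces. -/
def aliveAbove (d : ℕ) (H : Set (Finset V)) (j : ℕ) (τ : Finset V) : Set (Finset V) :=
  {σ | σ ∈ H ∧ τ ⊆ σ ∧
    ∀ τ' : Finset V, τ'.card = d → τ' ⊆ σ → τ' ≠ τ → ¬ message d H j τ' σ}

theorem mem_aliveAbove_of_mem_core {d : ℕ} {H : Set (Finset V)} {j : ℕ} {τ σ : Finset V}
    (hσ : σ ∈ core d H j) (h : τ ⊆ σ) : σ ∈ aliveAbove d H j τ :=
  ⟨core_antitone d H (Nat.zero_le j) hσ, h,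
    fun _ h1 h2 _ hm => not_mem_core_of_message h1 h2 hm hσ⟩

/-- An alive face that is pruned must get its message from `τ` itself. That message needs every
other face above `τ` to receive one from a further facet, which a second alive face rules out. The
threshold two is essential here. -/
theorem aliveAbove_subset_core {d : ℕ} {H : Set (Finset V)} {j : ℕ} {τ : Finset V}
    (h : 2 ≤ (aliveAbove d H j τ).ncard) : aliveAbove d H j τ ⊆ {σ | σ ∈ core d H j ∧ τ ⊆ σ} := by
  intro σ hσ
  refine ⟨?_, hσ.2.1⟩
  by_contra hn
  obtain ⟨τ', h1, h2, h3⟩ := exists_message_of_not_mem_core hσ.1 hn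
  obtain rfl : τ' = τ := by
    by_contra hne
    exact hσ.2.2 τ' h1 h2 hne h3
  cases j with
  | zero => exact h3
  | succ j =>
    obtain ⟨σ', hσ', hne⟩ := Set.exists_ne_of_one_lt_ncard (show 1 < (aliveAbove d H (j + 1) τ').ncard from h) σ
    obtain ⟨τ'', a, b, c, e⟩ := h3 σ' hσ'.1 hσ'.2.1 hne
    exact hσ'.2.2 τ'' a b c (message_succ e)

/-- Surviving the last pruning means having company above `τ` one stage earlier, hence the drop in
the level. -/
theorem two_le_ncard_aliveAbove [Finite V] {d : ℕ} {H : Set (Finset V)} {j : ℕ} {τ : Finset V}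
    (h : τ ∈ shadow d (core d H (j + 1))) : 2 ≤ (aliveAbove d H j τ).ncard := by
  obtain ⟨hτ, σ, hσ, hsub⟩ := h
  obtain ⟨σ', h1, h2, h3⟩ := hσ.2 τ hτ hsub
  have : (1 : ℕ) < (aliveAbove d H j τ).ncard :=
    (Set.one_lt_ncard (Set.toFinite _)).mpr ⟨σ, mem_aliveAbove_of_mem_core hσ.1 hsub, σ',
      mem_aliveAbove_of_mem_core h1 h3, h2.symm⟩
  omega

end Messages

/-- Every survivor has `d + 1` facets, so the survivors are counted by incidences divided by `d +
1`; the shadow is bounded by the faces with two alive faces one level below. Truncating at `M` only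
loses incidences, and makes the summands bounded for Chebyshev's inequality. -/
theorem core_surplus_ge {V : Type*} [Fintype V] {d : ℕ} {H : Set (Finset V)}
    (hH : ∀ σ ∈ H, σ.card = d + 1) (k M : ℕ) :
    ∑ τ ∈ Finset.powersetCard d (Finset.univ : Finset V),
      ((if 2 ≤ (aliveAbove d H (k + 1) τ).ncard then
          ((min M (aliveAbove d H (k + 1) τ).ncard : ℕ) : ℝ) else 0) / (d + 1) -
        if 2 ≤ (aliveAbove d H k τ).ncard then 1 else 0) ≤
      ((core d H (k + 1)).ncard : ℝ) - ((shadow d (core d H (k + 1))).ncard : ℝ) := by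
  classical
  rw [Finset.sum_sub_distrib, ← Finset.sum_div]
  refine sub_le_sub ?_ ?_
  · rw [div_le_iff₀ (by positivity)]
    have hfin : (core d H (k + 1)).Finite := Set.toFinite _
    have hcount := Finset.sum_card_bipartiteAbove_eq_sum_card_bipartiteBelow
      (s := Finset.powersetCard d (Finset.univ : Finset V)) (t := hfin.toFinset) (· ⊆ ·)
    have hb : ∀ σ ∈ hfin.toFinset, (Finset.bipartiteBelow (· ⊆ ·)
        (Finset.powersetCard d (Finset.univ : Finset V)) σ).card = d + 1 := by
      intro σ hσ
      have hc : σ.card = d + 1 :=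
        hH σ (core_antitone d H (Nat.zero_le (k + 1)) (hfin.mem_toFinset.mp hσ))
      have : Finset.bipartiteBelow (· ⊆ ·) (Finset.powersetCard d (Finset.univ : Finset V)) σ =
          Finset.powersetCard d σ := by
        ext τ
        simp [Finset.mem_bipartiteBelow, Finset.mem_powersetCard, and_comm]
      rw [this, Finset.card_powersetCard, hc, Nat.choose_succ_self_right]
    rw [Finset.sum_congr rfl hb, Finset.sum_const, smul_eq_mul,
      ← Set.ncard_eq_toFinset_card] at hcount
    have hcast : ((core d H (k + 1)).ncard : ℝ) * (d + 1) =
        ∑ τ ∈ Finset.powersetCard d (Finset.univ : Finset V),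
          ((Finset.bipartiteAbove (· ⊆ ·) hfin.toFinset τ).card : ℝ) := by
      exact_mod_cast hcount.symm
    rw [hcast]
    refine Finset.sum_le_sum fun τ _ => ?_
    split_ifs with h
    · refine Nat.cast_le.mpr ((min_le_right _ _).trans ?_)
      rw [← Set.ncard_coe_finset]
      refine Set.ncard_le_ncard ?_ (Set.toFinite _)
      intro σ hσ
      have := aliveAbove_subset_core h hσ
      simpa [Finset.mem_bipartiteAbove] using this
    · positivity
  · rw [Finset.sum_boole]
    refine Nat.cast_le.mpr ?_
    rw [← Set.ncard_coe_finset]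
    refine Set.ncard_le_ncard ?_ (Set.toFinite _)
    intro τ hτ
    simp only [Finset.coe_filter, Finset.mem_powersetCard_univ, Set.mem_ofPred_eq]
    exact ⟨hτ.1, two_le_ncard_aliveAbove hτ⟩

/-! ### Labelled trees explored from a `(d-1)`-face -/

section Clusters

variable {V : Type} {d : ℕ}

variable (V d) in
/-- Trees of depth `m` that record, for every possible vertex `v`, whether the `d`-face obtained by
adding `v` is present, and if so, the trees at its other `d` faces. -/
def Cluster : ℕ → Type
  | 0 => PUnit
  | m + 1 => V → Option (Fin d → Cluster m)

/-- The root of the tree is collapsed from below. -/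
def Cluster.Dead : ∀ {m : ℕ}, Cluster V d m → Prop
  | 0, _ => False
  | _ + 1, C => ∀ v f, C v = some f → ∃ i, Cluster.Dead (f i)

open Classical in
/-- The number of `d`-faces at the root that are not collapsed from below. -/
noncomputable def Cluster.aliveCount [Fintype V] {m : ℕ} (C : Cluster V d (m + 1)) : ℕ :=
  (Finset.univ.filter fun v => ∃ f, C v = some f ∧ ∀ i, ¬ Cluster.Dead (f i)).card

variable [DecidableEq V]

instance Cluster.instFintype [Fintype V] : ∀ m, Fintype (Cluster V d m)
  | 0 => inferInstanceAs (Fintype PUnit)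
  | m + 1 =>
    have := Cluster.instFintype m
    inferInstanceAs (Fintype (V → Option (Fin d → Cluster V d m)))

/-- The set of entries of a tuple of vertices. -/
def verts (t : Fin d → V) : Finset V := Finset.univ.image t

open Classical in
/-- The tree seen in `H` from the `(d-1)`-face `t`, entered from `W`. -/
noncomputable def clusterOf (H : Set (Finset V)) :
    ∀ m : ℕ, (Fin d → V) → Finset V → Cluster V d m
  | 0, _, _ => PUnit.unit
  | m + 1, t, W => fun v =>
    if v ∉ W ∧ insert v (verts t) ∈ H then
      some fun i => clusterOf H m (Function.update t i v) (insert v (verts t))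
    else none

theorem mem_verts {t : Fin d → V} {v : V} : v ∈ verts t ↔ ∃ i, t i = v := by simp [verts]

theorem card_verts {t : Fin d → V} (ht : Function.Injective t) : (verts t).card = d := by
  rw [verts, Finset.card_image_of_injective _ ht, Finset.card_univ, Fintype.card_fin]

theorem mem_verts_update {t : Fin d → V} (ht : Function.Injective t) {i : Fin d} {v w : V} :
    w ∈ verts (Function.update t i v) ↔ w = v ∨ (w ∈ verts t ∧ w ≠ t i) := by
  simp only [mem_verts]
  constructor
  · rintro ⟨j, rfl⟩
    by_cases h : j = i
    · subst h; simp
    · right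
      rw [Function.update_of_ne h]
      exact ⟨⟨j, rfl⟩, fun e => h (ht e)⟩
  · rintro (rfl | ⟨⟨j, rfl⟩, h⟩)
    · exact ⟨i, by simp⟩
    · exact ⟨j, Function.update_of_ne (fun e => h (congrArg t e)) _ _⟩

theorem verts_update_subset (t : Fin d → V) (i : Fin d) (v : V) :
    verts (Function.update t i v) ⊆ insert v (verts t) := by
  intro x hx
  obtain ⟨j, rfl⟩ := mem_verts.mp hx
  by_cases h : j = i
  · subst h; simp
  · rw [Function.update_of_ne h]
    exact Finset.mem_insert_of_mem (mem_verts.mpr ⟨j, rfl⟩)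

theorem mem_verts_update_self (t : Fin d → V) (i : Fin d) (v : V) :
    v ∈ verts (Function.update t i v) := mem_verts.mpr ⟨i, by simp⟩

theorem injective_update {t : Fin d → V} (ht : Function.Injective t) {v : V} (hv : v ∉ verts t)
    (i : Fin d) : Function.Injective (Function.update t i v) := by
  intro a b hab
  have hv' : ∀ j, t j ≠ v := fun j e => hv (mem_verts.mpr ⟨j, e⟩)
  by_cases ha : a = i <;> by_cases hb : b = i
  · rw [ha, hb]
  · subst ha
    rw [Function.update_self, Function.update_of_ne hb] at hab
    exact absurd hab.symm (hv' b)
  · subst hb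
    rw [Function.update_self, Function.update_of_ne ha] at hab
    exact absurd hab (hv' a)
  · rw [Function.update_of_ne ha, Function.update_of_ne hb] at hab
    exact ht hab

theorem insert_verts_update {t : Fin d → V} (ht : Function.Injective t) {v : V}
    (i : Fin d) :
    insert (t i) (verts (Function.update t i v)) = insert v (verts t) := by
  have : t i ∈ verts t := mem_verts.mpr ⟨i, rfl⟩
  ext w
  simp only [Finset.mem_insert, mem_verts_update ht]
  by_cases h : w = t i
  · subst h; simp [this]
  · simp [h]

/-- Overwriting one entry of the tuple by `v` lists the other facets of the `d`-face, indexed by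
`Fin d`. Tuples instead of sets give the trees a fixed branching index that does not depend on the
face. -/
theorem facet_iff {t : Fin d → V} (ht : Function.Injective t) {v : V} (hv : v ∉ verts t)
    (τ : Finset V) :
    (τ.card = d ∧ τ ⊆ insert v (verts t) ∧ τ ≠ verts t) ↔
      ∃ i, τ = verts (Function.update t i v) := by
  constructor
  · rintro ⟨h1, h2, h3⟩
    have hc : (insert v (verts t)).card = d + 1 := by
      rw [Finset.card_insert_of_notMem hv, card_verts ht]
    have : (insert v (verts t) \ τ).card = 1 := by
      rw [Finset.card_sdiff_of_subset h2, hc, h1]; omega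
    obtain ⟨x, hx⟩ := Finset.card_eq_one.mp this
    have hxm : x ∈ insert v (verts t) ∧ x ∉ τ := by
      rw [← Finset.mem_sdiff, hx]; simp
    have hxv : x ≠ v := by
      rintro rfl
      refine h3 (Finset.eq_of_subset_of_card_le ?_ (by rw [h1, card_verts ht]))
      intro y hy
      rcases Finset.mem_insert.mp (h2 hy) with rfl | h
      · exact absurd hy hxm.2
      · exact h
    obtain ⟨i, hi⟩ := mem_verts.mp ((Finset.mem_insert.mp hxm.1).resolve_left hxv)
    refine ⟨i, Finset.eq_of_subset_of_card_le ?_ ?_⟩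
    · intro y hy
      rw [mem_verts_update ht]
      rcases Finset.mem_insert.mp (h2 hy) with h | h
      · exact Or.inl h
      · refine Or.inr ⟨h, ?_⟩
        rintro rfl
        exact hxm.2 (hi ▸ hy)
    · rw [card_verts (injective_update ht hv i), h1]
  · rintro ⟨i, rfl⟩
    refine ⟨card_verts (injective_update ht hv i), ?_, ?_⟩
    · rw [← insert_verts_update ht i]
      exact Finset.subset_insert _ _
    · intro e
      exact hv (e ▸ (mem_verts_update ht).mpr (Or.inl rfl))

theorem exists_insert_of_subset {τ σ : Finset V} (hτ : τ.card = d) (hσ : σ.card = d + 1)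
    (h : τ ⊆ σ) : ∃ v ∉ τ, σ = insert v τ := by
  obtain ⟨v, hv, e⟩ := Finset.exists_eq_insert_iff.mpr ⟨h, by rw [hτ, hσ]⟩
  exact ⟨v, hv, e.symm⟩

theorem insert_injOn {τ : Finset V} {v w : V} (hv : v ∉ τ) (h : insert v τ = insert w τ) :
    v = w := by
  have : v ∈ insert w τ := h ▸ Finset.mem_insert_self v τ
  exact (Finset.mem_insert.mp this).resolve_right hv

/-- The tree recursion and the message recursion coincide: excluding labels in the entrance set
`insert u (verts t)` is the ban on turning back to the `d`-face just used. -/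
theorem dead_clusterOf_iff {H : Set (Finset V)} (hH : ∀ σ ∈ H, σ.card = d + 1) (m : ℕ)
    {t : Fin d → V} (ht : Function.Injective t) {u : V} (hu : u ∉ verts t) :
    (clusterOf H m t (insert u (verts t))).Dead ↔
      message d H m (verts t) (insert u (verts t)) := by
  induction m generalizing t u with
  | zero => rfl
  | succ m ih =>
    -- Seen from the child, the entrance `insert v (verts t)` is its own vertex set together with
    -- the dropped vertex `t i`, which has the shape required by the induction hypothesis.
    have hstep : ∀ v ∉ verts t, ∀ i,
        (clusterOf H m (Function.update t i v) (insert v (verts t))).Dead ↔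
        message d H m (verts (Function.update t i v)) (insert v (verts t)) := by
      intro v hv i
      have hnot : t i ∉ verts (Function.update t i v) := by
        rw [mem_verts_update ht]
        rintro (h | h)
        · exact hv (mem_verts.mpr ⟨i, h⟩)
        · exact h.2 rfl
      have := ih (injective_update ht hv i) hnot
      rwa [insert_verts_update ht i] at this
    have hC : (clusterOf H (m + 1) t (insert u (verts t))).Dead ↔
        ∀ v, v ∉ insert u (verts t) → insert v (verts t) ∈ H →
          ∃ i, (clusterOf H m (Function.update t i v) (insert v (verts t))).Dead := by
      constructor
      · intro h v hv hm
        exact h v _ (if_pos ⟨hv, hm⟩)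
      · intro h v f hf
        by_cases hc : v ∉ insert u (verts t) ∧ insert v (verts t) ∈ H
        · have h1 : clusterOf H (m + 1) t (insert u (verts t)) v = some _ := if_pos hc
          rw [h1, Option.some_inj] at hf
          subst hf
          exact h v hc.1 hc.2
        · have h1 : clusterOf H (m + 1) t (insert u (verts t)) v = none := if_neg hc
          rw [h1] at hf
          cases hf
    rw [hC]
    constructor
    · intro h σ hσ hsub hne
      obtain ⟨v, hv, rfl⟩ := exists_insert_of_subset (card_verts ht) (hH σ hσ) hsub
      have hvu : v ∉ insert u (verts t) := by
        rw [Finset.mem_insert]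
        rintro (rfl | h')
        · exact hne rfl
        · exact hv h'
      obtain ⟨i, hi⟩ := h v hvu hσ
      obtain ⟨a, b, e⟩ := (facet_iff ht hv _).mpr ⟨i, rfl⟩
      exact ⟨_, a, b, e, (hstep v hv i).mp hi⟩
    · intro h v hvu hm
      rw [Finset.mem_insert, not_or] at hvu
      obtain ⟨τ', a, b, e, hm'⟩ := h _ hm (Finset.subset_insert _ _)
        (fun e => hvu.1 (insert_injOn hvu.2 e))
      obtain ⟨i, rfl⟩ := (facet_iff ht hvu.2 τ').mp ⟨a, b, e⟩
      exact ⟨i, (hstep v hvu.2 i).mpr hm'⟩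

/-- At the root the entrance set is only `verts t`, so no `d`-face above it is excluded. One level
of the tree is spent on these faces, so depth `m + 1` sees messages of level `m`. -/
theorem aliveCount_clusterOf [Fintype V] {H : Set (Finset V)} (hH : ∀ σ ∈ H, σ.card = d + 1) (m : ℕ)
    {t : Fin d → V} (ht : Function.Injective t) :
    (clusterOf H (m + 1) t (verts t)).aliveCount = (aliveAbove d H m (verts t)).ncard := by
  classical
  have hstep : ∀ v ∉ verts t, ∀ i,
      (clusterOf H m (Function.update t i v) (insert v (verts t))).Dead ↔
      message d H m (verts (Function.update t i v)) (insert v (verts t)) := by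
    intro v hv i
    have hnot : t i ∉ verts (Function.update t i v) := by
      rw [mem_verts_update ht]
      rintro (h | h)
      · exact hv (mem_verts.mpr ⟨i, h⟩)
      · exact h.2 rfl
    have := dead_clusterOf_iff hH m (injective_update ht hv i) hnot
    rwa [insert_verts_update ht i] at this
  have hmem : ∀ v, (∃ f, clusterOf H (m + 1) t (verts t) v = some f ∧ ∀ i, ¬ (f i).Dead) ↔
      v ∉ verts t ∧ insert v (verts t) ∈ H ∧
        ∀ i, ¬ message d H m (verts (Function.update t i v)) (insert v (verts t)) := by
    intro v
    by_cases hc : v ∉ verts t ∧ insert v (verts t) ∈ H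
    · have h1 : clusterOf H (m + 1) t (verts t) v = some _ := if_pos hc
      rw [h1]
      constructor
      · rintro ⟨f, hf, hd⟩
        rw [Option.some_inj] at hf
        subst hf
        exact ⟨hc.1, hc.2, fun i h => hd i ((hstep v hc.1 i).mpr h)⟩
      · rintro ⟨-, -, h⟩
        exact ⟨_, rfl, fun i hd => h i ((hstep v hc.1 i).mp hd)⟩
    · have h1 : clusterOf H (m + 1) t (verts t) v = none := if_neg hc
      rw [h1]
      constructor
      · rintro ⟨f, hf, -⟩
        cases hf
      · rintro ⟨a, b, -⟩
        exact absurd ⟨a, b⟩ hc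
  have himg : aliveAbove d H m (verts t) = (fun v => insert v (verts t)) ''
      {v | ∃ f, clusterOf H (m + 1) t (verts t) v = some f ∧ ∀ i, ¬ (f i).Dead} := by
    ext σ
    simp only [Set.mem_image, Set.mem_ofPred_eq, hmem]
    constructor
    · rintro ⟨h1, h2, h3⟩
      obtain ⟨v, hv, rfl⟩ := exists_insert_of_subset (card_verts ht) (hH σ h1) h2
      refine ⟨v, ⟨hv, h1, fun i => ?_⟩, rfl⟩
      obtain ⟨a, b, e⟩ := (facet_iff ht hv _).mpr ⟨i, rfl⟩
      exact h3 _ a b e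
    · rintro ⟨v, ⟨hv, h1, h2⟩, rfl⟩
      refine ⟨h1, Finset.subset_insert _ _, fun τ' a b e => ?_⟩
      obtain ⟨i, rfl⟩ := (facet_iff ht hv τ').mp ⟨a, b, e⟩
      exact h2 i
  rw [himg, Set.InjOn.ncard_image, Cluster.aliveCount, ← Set.ncard_coe_finset]
  · simp
  · intro v hv w _ e
    exact insert_injOn ((hmem v).mp hv).1 e

end Clusters

end RandomComplex

namespace RandomComplex

/-! ### Finite product weights and expectations -/

section ProductWeights

variable {ι β : Type*} [Fintype ι]

/-- The product weights on families. -/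
def piWeight (w : β → ℝ) (x : ι → β) : ℝ := ∏ i, w (x i)

theorem piWeight_nonneg {w : β → ℝ} (hw : ∀ b, 0 ≤ w b) (x : ι → β) : 0 ≤ piWeight w x :=
  Finset.prod_nonneg fun _ _ => hw _

/-- The weights of an optional family that is present with probability `p`. -/
def optWeight (p : ℝ) (w : β → ℝ) (o : Option (ι → β)) : ℝ :=
  o.elim (1 - p) fun f => p * piWeight w f

theorem optWeight_nonneg {p : ℝ} (hp0 : 0 ≤ p) (hp1 : p ≤ 1) {w : β → ℝ} (hw : ∀ b, 0 ≤ w b)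
    (o : Option (ι → β)) : 0 ≤ optWeight p w o := by
  cases o with
  | none => simpa [optWeight] using hp1
  | some f => exact mul_nonneg hp0 (piWeight_nonneg hw f)

variable [Fintype β]

/-- The expectation of `f` under the weights `w`. -/
def expect (w : β → ℝ) (f : β → ℝ) : ℝ := ∑ b, w b * f b

theorem expect_mono {w : β → ℝ} (hw : ∀ b, 0 ≤ w b) {f g : β → ℝ} (h : ∀ b, f b ≤ g b) :
    expect w f ≤ expect w g :=
  Finset.sum_le_sum fun b _ => mul_le_mul_of_nonneg_left (h b) (hw b)

theorem expect_nonneg {w : β → ℝ} (hw : ∀ b, 0 ≤ w b) {f : β → ℝ} (h : ∀ b, 0 ≤ f b) :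
    0 ≤ expect w f :=
  Finset.sum_nonneg fun b _ => mul_nonneg (hw b) (h b)

theorem expect_add (w f g : β → ℝ) : expect w (fun b => f b + g b) = expect w f + expect w g := by
  simp [expect, mul_add, Finset.sum_add_distrib]

theorem expect_sub (w f g : β → ℝ) : expect w (fun b => f b - g b) = expect w f - expect w g := by
  simp [expect, mul_sub, Finset.sum_sub_distrib]

theorem expect_const_mul (w : β → ℝ) (a : ℝ) (f : β → ℝ) :
    expect w (fun b => a * f b) = a * expect w f := by
  simp only [expect, Finset.mul_sum]
  exact Finset.sum_congr rfl fun _ _ => by ring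

theorem expect_sum {κ : Type*} (s : Finset κ) (w : β → ℝ) (f : κ → β → ℝ) :
    expect w (fun b => ∑ k ∈ s, f k b) = ∑ k ∈ s, expect w (f k) := by
  simp only [expect, Finset.mul_sum]
  exact Finset.sum_comm

theorem expect_const {w : β → ℝ} (hw : ∑ b, w b = 1) (a : ℝ) : expect w (fun _ => a) = a := by
  simp [expect, ← Finset.sum_mul, hw]

variable [DecidableEq ι]

/-- Independence in its general form; marginals, pairwise factorization and the binomial formulas
are obtained by choosing the factors. -/
theorem expect_piWeight_prod (w : β → ℝ) (f : ι → β → ℝ) :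
    expect (piWeight w) (fun x : ι → β => ∏ i, f i (x i)) = ∏ i, expect w (f i) := by
  simp only [expect, piWeight, ← Finset.prod_mul_distrib]
  rw [Finset.prod_univ_sum, Fintype.piFinset_univ]

theorem sum_piWeight {w : β → ℝ} (hw : ∑ b, w b = 1) : ∑ x : ι → β, piWeight w x = 1 := by
  have := expect_piWeight_prod (ι := ι) w fun _ _ => 1
  simpa [expect, hw] using this

theorem expect_piWeight_eval {w : β → ℝ} (hw : ∑ b, w b = 1) (i : ι) (f : β → ℝ) :
    expect (piWeight w) (fun x : ι → β => f (x i)) = expect w f := by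
  have := expect_piWeight_prod (ι := ι) w fun j b => if j = i then f b else 1
  rw [Finset.prod_eq_single i] at this
  · simpa using this
  · intro j _ hj
    simpa [hj, expect] using hw
  · simp

theorem expect_piWeight_eval_mul {w : β → ℝ} (hw : ∑ b, w b = 1) {i j : ι} (hij : i ≠ j)
    (f g : β → ℝ) :
    expect (piWeight w) (fun x : ι → β => f (x i) * g (x j)) = expect w f * expect w g := by
  have := expect_piWeight_prod (ι := ι) w
    fun k b => (if k = i then f b else 1) * (if k = j then g b else 1)
  have hp : ∀ x : ι → β, ∏ k, (if k = i then f (x k) else 1) * (if k = j then g (x k) else 1) =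
      f (x i) * g (x j) := by
    intro x
    rw [Finset.prod_mul_distrib, Finset.prod_ite_eq', Finset.prod_ite_eq',
      if_pos (Finset.mem_univ _), if_pos (Finset.mem_univ _)]
  simp only [hp] at this
  rw [Finset.prod_eq_mul i j hij] at this
  · simpa [hij, hij.symm] using this
  · intro k _ hk
    simpa [hk.1, hk.2, expect] using hw
  · simp
  · simp

/-- The second factorial moment of a sum of independent variables. -/
theorem expect_piWeight_factorial_le {w : β → ℝ} (hw0 : ∀ b, 0 ≤ w b) (hw : ∑ b, w b = 1)
    {f : ι → β → ℝ} (hf : ∀ i b, 0 ≤ f i b) :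
    expect (piWeight w) (fun x : ι → β => (∑ i, f i (x i)) * ((∑ i, f i (x i)) - 1)) ≤
      ∑ i, expect w (fun b => f i b * (f i b - 1)) + (∑ i, expect w (f i)) ^ 2 := by
  have hsplit : ∀ x : ι → β, (∑ i, f i (x i)) * ((∑ i, f i (x i)) - 1) =
      ∑ i, f i (x i) * (f i (x i) - 1) +
        ∑ i, ∑ j ∈ Finset.univ.erase i, f i (x i) * f j (x j) := by
    intro x
    rw [mul_sub, mul_one, Finset.sum_mul_sum, ← Finset.sum_add_distrib, ← Finset.sum_sub_distrib]
    refine Finset.sum_congr rfl fun i _ => ?_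
    rw [← Finset.add_sum_erase _ _ (Finset.mem_univ i)]
    ring
  simp only [hsplit]
  rw [expect_add, expect_sum]
  refine add_le_add (Finset.sum_le_sum fun i _ => ?_) ?_
  · rw [expect_piWeight_eval hw i fun b => f i b * (f i b - 1)]
  · rw [expect_sum, sq, Finset.sum_mul_sum]
    refine Finset.sum_le_sum fun i _ => ?_
    rw [expect_sum]
    calc ∑ j ∈ Finset.univ.erase i,
          expect (piWeight w) (fun x : ι → β => f i (x i) * f j (x j))
        = ∑ j ∈ Finset.univ.erase i, expect w (f i) * expect w (f j) :=
          Finset.sum_congr rfl fun j hj =>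
            expect_piWeight_eval_mul hw (Finset.ne_of_mem_erase hj).symm _ _
      _ ≤ _ := Finset.sum_le_sum_of_subset_of_nonneg (Finset.erase_subset _ _)
          fun j _ _ => mul_nonneg (expect_nonneg hw0 (hf i)) (expect_nonneg hw0 (hf j))

theorem expect_optWeight (p : ℝ) (w : β → ℝ) (F : Option (ι → β) → ℝ) :
    expect (optWeight p w) F =
      (1 - p) * F none + p * expect (piWeight w) fun f => F (some f) := by
  simp only [expect, Fintype.sum_option, optWeight, Option.elim, Finset.mul_sum, mul_assoc]

theorem sum_optWeight (p : ℝ) {w : β → ℝ} (hw : ∑ b, w b = 1) :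
    ∑ o : Option (ι → β), optWeight p w o = 1 := by
  have := expect_optWeight (ι := ι) p w fun _ => 1
  simp only [expect, mul_one, sum_piWeight hw] at this
  linarith

end ProductWeights

/-! ### The law of the random tree; repeated labels are rare -/

section ClusterWeights

variable {V : Type} {d : ℕ} [Fintype V]

/-- The law of a tree in which all faces are present independently with probability `p`. -/
def Cluster.weight (p : ℝ) : ∀ m, Cluster V d m → ℝ
  | 0, _ => 1
  | m + 1, C => piWeight (optWeight p (Cluster.weight p m)) C

theorem Cluster.weight_nonneg {p : ℝ} (hp0 : 0 ≤ p) (hp1 : p ≤ 1) (m : ℕ) (C : Cluster V d m) :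
    0 ≤ Cluster.weight p m C := by
  induction m with
  | zero => exact zero_le_one
  | succ m ih => exact piWeight_nonneg (optWeight_nonneg hp0 hp1 ih) C

variable [DecidableEq V]

theorem Cluster.sum_weight (p : ℝ) (m : ℕ) : ∑ C : Cluster V d m, Cluster.weight p m C = 1 := by
  induction m with
  | zero =>
    change ∑ C : PUnit, (1 : ℝ) = 1
    simp
  | succ m ih => exact sum_piWeight (sum_optWeight p ih)

/-- How often the vertex `u` is the label of a `d`-face of the tree. -/
def Cluster.count (u : V) : ∀ {m}, Cluster V d m → ℕ
  | 0, _ => 0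
  | _ + 1, C => ∑ v, (C v).elim 0 fun f =>
      (if v = u then 1 else 0) + ∑ i, Cluster.count u (f i)

/-- A label occurs either as a root label, with probability p, or in one of `d` subtrees below one
of about n p ≤ c present root labels. Factorial moments are used because they are of order p², and n
p² ≤ c p after summing over all labels. -/
theorem exists_moment_bounds (d : ℕ) {c : ℝ} (hc : 0 ≤ c) (m : ℕ) :
    ∃ α β : ℝ, 0 ≤ α ∧ 0 ≤ β ∧ ∀ (n : ℕ) (p : ℝ), 0 ≤ p → p ≤ 1 → n * p ≤ c → ∀ u : Fin n,
      expect (Cluster.weight (V := Fin n) (d := d) p m) (fun C => (C.count u : ℝ)) ≤ α * p ∧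
      expect (Cluster.weight (V := Fin n) (d := d) p m)
        (fun C => (C.count u : ℝ) * ((C.count u : ℝ) - 1)) ≤ β * p ^ 2 := by
  induction m with
  | zero =>
    refine ⟨0, 0, le_rfl, le_rfl, fun n p _ _ _ u => ?_⟩
    simp [expect, Cluster.count]
  | succ m ih =>
    obtain ⟨α, β, hα, hβ, h⟩ := ih
    -- These constants solve the recursion. In the second one, the last square collects pairs of
    -- occurrences below different root labels; the other terms come from pairs below the same one,
    -- with 2dα for pairs that involve the root label itself.
    refine ⟨1 + c * (d * α), c * (d * β + (d * α) ^ 2) + 2 * (d * α) + (1 + c * (d * α)) ^ 2,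
      by positivity, by positivity, fun n p hp0 hp1 hnp u => ?_⟩
    obtain ⟨h1, h2⟩ := h n p hp0 hp1 hnp u
    set w := Cluster.weight (V := Fin n) (d := d) p m with hw
    have hw0 : ∀ C, 0 ≤ w C := Cluster.weight_nonneg hp0 hp1 m
    have hw1 : ∑ C, w C = 1 := Cluster.sum_weight p m
    let T : (Fin d → Cluster (Fin n) d m) → ℝ := fun f => ∑ i, ((f i).count u : ℝ)
    have hT0 : ∀ f, 0 ≤ T f := fun f => Finset.sum_nonneg fun _ _ => Nat.cast_nonneg _
    have hT1 : expect (piWeight w) T ≤ d * α * p := by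
      have : expect (piWeight w) T = ∑ i : Fin d, expect w fun C => (C.count u : ℝ) := by
        simp only [T]
        rw [expect_sum]
        exact Finset.sum_congr rfl fun i _ =>
          expect_piWeight_eval hw1 i fun C => (C.count u : ℝ)
      rw [this, Finset.sum_const, Finset.card_univ, Fintype.card_fin, nsmul_eq_mul, mul_assoc]
      gcongr
    have hT1' : 0 ≤ expect (piWeight w) T := expect_nonneg (piWeight_nonneg hw0) hT0
    have hT2 : expect (piWeight w) (fun f => T f * (T f - 1)) ≤
        (d * β + (d * α) ^ 2) * p ^ 2 := by
      refine (expect_piWeight_factorial_le (ι := Fin d) hw0 hw1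
        (f := fun _ C => (C.count u : ℝ)) fun _ _ => Nat.cast_nonneg _).trans ?_
      rw [Finset.sum_const, Finset.sum_const, Finset.card_univ, Fintype.card_fin, nsmul_eq_mul,
        nsmul_eq_mul]
      have e1 : 0 ≤ expect w (fun C => (C.count u : ℝ)) :=
        expect_nonneg hw0 fun _ => Nat.cast_nonneg _
      have e2 : (d * expect w (fun C => (C.count u : ℝ))) ^ 2 ≤ (d * (α * p)) ^ 2 := by gcongr
      have e3 : d * expect w (fun C => (C.count u : ℝ) * ((C.count u : ℝ) - 1)) ≤
          d * (β * p ^ 2) := by gcongr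
      nlinarith
    let Z : Fin n → Option (Fin d → Cluster (Fin n) d m) → ℝ := fun v o =>
      o.elim 0 fun f => (if v = u then 1 else 0) + T f
    have hZ0 : ∀ v o, 0 ≤ Z v o := by
      intro v o
      cases o with
      | none => exact le_rfl
      | some f =>
        have := hT0 f
        simp only [Z, Option.elim]
        split_ifs <;> linarith
    have hcount : ∀ C : Cluster (Fin n) d (m + 1), (C.count u : ℝ) = ∑ v, Z v (C v) := by
      intro C
      simp only [Cluster.count, Nat.cast_sum, Z, T]
      refine Finset.sum_congr rfl fun v _ => ?_
      cases C v <;> simp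
    have hZ1 : ∑ v, expect (optWeight p w) (Z v) ≤ (1 + c * (d * α)) * p := by
      have : ∀ v, expect (optWeight p w) (Z v) =
          p * (if v = u then 1 else 0) + p * expect (piWeight w) T := by
        intro v
        rw [expect_optWeight]
        simp only [Z, Option.elim]
        rw [expect_add, expect_const (sum_piWeight hw1)]
        ring
      simp only [this, Finset.sum_add_distrib, ← Finset.mul_sum]
      rw [Finset.sum_ite_eq', if_pos (Finset.mem_univ u), Finset.sum_const, Finset.card_univ,
        Fintype.card_fin, nsmul_eq_mul]
      have : p * ((n : ℝ) * expect (piWeight w) T) ≤ c * (d * α * p) := by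
        rw [← mul_assoc, mul_comm p]
        gcongr
      linarith
    have hZ1' : 0 ≤ ∑ v, expect (optWeight p w) (Z v) :=
      Finset.sum_nonneg fun v _ => expect_nonneg (optWeight_nonneg hp0 hp1 hw0) (hZ0 v)
    have hZ2 : ∑ v, expect (optWeight p w) (fun o => Z v o * (Z v o - 1)) ≤
        (c * (d * β + (d * α) ^ 2) + 2 * (d * α)) * p ^ 2 := by
      have : ∀ v, expect (optWeight p w) (fun o => Z v o * (Z v o - 1)) =
          p * expect (piWeight w) (fun f => T f * (T f - 1)) +
            (if v = u then 2 * p * expect (piWeight w) T else 0) := by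
        intro v
        rw [expect_optWeight]
        simp only [Z, Option.elim]
        split_ifs with hv
        · have : ∀ f, (1 + T f) * (1 + T f - 1) = T f * (T f - 1) + 2 * T f := fun f => by ring
          simp only [this]
          rw [expect_add, expect_const_mul]
          ring
        · simp
      simp only [this, Finset.sum_add_distrib]
      rw [Finset.sum_ite_eq', if_pos (Finset.mem_univ u), Finset.sum_const, Finset.card_univ,
        Fintype.card_fin, nsmul_eq_mul, ← mul_assoc]
      have e1 : (n : ℝ) * p * expect (piWeight w) (fun f => T f * (T f - 1)) ≤
          c * ((d * β + (d * α) ^ 2) * p ^ 2) := by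
        refine (mul_le_mul_of_nonneg_left hT2 (by positivity)).trans ?_
        gcongr
      have e2 : 2 * p * expect (piWeight w) T ≤ 2 * p * (d * α * p) := by gcongr
      nlinarith
    have hwt : Cluster.weight (V := Fin n) (d := d) p (m + 1) = piWeight (optWeight p w) := rfl
    constructor
    · have : expect (Cluster.weight (V := Fin n) (d := d) p (m + 1)) (fun C => (C.count u : ℝ)) =
          ∑ v, expect (optWeight p w) (Z v) := by
        simp only [hcount]
        rw [expect_sum, hwt]
        exact Finset.sum_congr rfl fun v _ => expect_piWeight_eval (sum_optWeight p hw1) v _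
      rw [this]
      exact hZ1
    · simp only [hcount]
      refine (expect_piWeight_factorial_le (optWeight_nonneg hp0 hp1 hw0)
        (sum_optWeight p hw1) hZ0).trans ?_
      have : (∑ v, expect (optWeight p w) (Z v)) ^ 2 ≤ ((1 + c * (d * α)) * p) ^ 2 := by gcongr
      nlinarith

/-- Two trees that share no labels, repeat no labels and use no label in `W`. -/
def Separated {m : ℕ} (W : Finset V) (x : Fin 2 → Cluster V d m) : Prop :=
  ∀ u, ∑ a, (x a).count u ≤ 1 ∧ (u ∈ W → ∑ a, (x a).count u = 0)

open Classical in
-- A failure is a label occurring twice or a label lying in the bounded set `W`. The first costs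
-- n·O(p²) = O(p), the second b·O(p).
theorem exists_not_separated_bound (d : ℕ) {c : ℝ} (hc : 0 ≤ c) (m : ℕ) (b : ℕ) :
    ∃ γ : ℝ, 0 ≤ γ ∧ ∀ (n : ℕ) (p : ℝ), 0 ≤ p → p ≤ 1 → n * p ≤ c → ∀ W : Finset (Fin n),
      W.card ≤ b →
      expect (piWeight (Cluster.weight (V := Fin n) (d := d) p m))
        (fun x : Fin 2 → Cluster (Fin n) d m => if Separated W x then 0 else 1) ≤ γ * p := by
  obtain ⟨α, β, hα, hβ, h⟩ := exists_moment_bounds d hc m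
  refine ⟨c * (2 * β + (2 * α) ^ 2) + b * (2 * α), by positivity,
    fun n p hp0 hp1 hnp W hW => ?_⟩
  set w := Cluster.weight (V := Fin n) (d := d) p m with hw
  have hw0 : ∀ C, 0 ≤ w C := Cluster.weight_nonneg hp0 hp1 m
  have hw1 : ∑ C, w C = 1 := Cluster.sum_weight p m
  let S : Fin n → (Fin 2 → Cluster (Fin n) d m) → ℝ := fun u x => ∑ a, ((x a).count u : ℝ)
  have hS : ∀ u x, S u x = ((∑ a, (x a).count u : ℕ) : ℝ) := fun u x => by simp [S]
  have hfac : ∀ k : ℕ, (0 : ℝ) ≤ (k : ℝ) * ((k : ℝ) - 1) := by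
    intro k
    rcases Nat.eq_zero_or_pos k with rfl | hk
    · simp
    · have : (1 : ℝ) ≤ k := by exact_mod_cast hk
      exact mul_nonneg (by linarith) (by linarith)
  -- The indicator of failure is dominated by moments: S(S-1) ≥ 1 for a repeated label, S ≥ 1 for a
  -- forbidden one.
  have hpt : ∀ x : Fin 2 → Cluster (Fin n) d m, (if Separated W x then (0 : ℝ) else 1) ≤
      ∑ u, S u x * (S u x - 1) + ∑ u ∈ W, S u x := by
    intro x
    have n1 : ∀ u ∈ Finset.univ, 0 ≤ S u x * (S u x - 1) := fun u _ => by rw [hS]; exact hfac _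
    have n2 : ∀ u ∈ W, 0 ≤ S u x := fun u _ => by rw [hS]; exact Nat.cast_nonneg _
    split_ifs with hsep
    · exact add_nonneg (Finset.sum_nonneg n1) (Finset.sum_nonneg n2)
    · unfold Separated at hsep
      push Not at hsep
      obtain ⟨u, hu⟩ := hsep
      by_cases h1 : ∑ a, (x a).count u ≤ 1
      · obtain ⟨huW, h0⟩ := hu h1
        have e1 : (1 : ℝ) ≤ S u x := by
          rw [hS]; exact_mod_cast Nat.one_le_iff_ne_zero.mpr h0
        have := Finset.single_le_sum n2 huW
        have := Finset.sum_nonneg n1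
        linarith
      · have e1 : (2 : ℝ) ≤ S u x := by
          rw [hS]; exact_mod_cast Nat.lt_of_not_le h1
        have e2 : 1 ≤ S u x * (S u x - 1) := by nlinarith
        have := Finset.single_le_sum n1 (Finset.mem_univ u)
        have := Finset.sum_nonneg n2
        linarith
  refine (expect_mono (piWeight_nonneg hw0) hpt).trans ?_
  rw [expect_add, expect_sum, expect_sum]
  have hS1 : ∀ u, expect (piWeight w) (S u) ≤ 2 * α * p := by
    intro u
    have : expect (piWeight w) (S u) = ∑ a : Fin 2, expect w fun C => (C.count u : ℝ) := by
      simp only [S]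
      rw [expect_sum]
      exact Finset.sum_congr rfl fun i _ =>
          expect_piWeight_eval hw1 i fun C => (C.count u : ℝ)
    rw [this, Finset.sum_const, Finset.card_univ, Fintype.card_fin, nsmul_eq_mul]
    have := (h n p hp0 hp1 hnp u).1
    push_cast
    linarith
  have hS2 : ∀ u, expect (piWeight w) (fun x => S u x * (S u x - 1)) ≤
      (2 * β + (2 * α) ^ 2) * p ^ 2 := by
    intro u
    obtain ⟨h1, h2⟩ := h n p hp0 hp1 hnp u
    refine (expect_piWeight_factorial_le (ι := Fin 2) hw0 hw1
      (f := fun _ C => (C.count u : ℝ)) fun _ _ => Nat.cast_nonneg _).trans ?_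
    rw [Finset.sum_const, Finset.sum_const, Finset.card_univ, Fintype.card_fin, nsmul_eq_mul,
      nsmul_eq_mul]
    have e1 : 0 ≤ expect w (fun C => (C.count u : ℝ)) :=
      expect_nonneg hw0 fun _ => Nat.cast_nonneg _
    push_cast
    have e2 : (2 * expect w (fun C => (C.count u : ℝ))) ^ 2 ≤ (2 * (α * p)) ^ 2 := by gcongr
    nlinarith
  have f1 : ∑ u, expect (piWeight w) (fun x => S u x * (S u x - 1)) ≤
      n * ((2 * β + (2 * α) ^ 2) * p ^ 2) := by
    refine (Finset.sum_le_sum fun u _ => hS2 u).trans ?_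
    simp
  have f2 : ∑ u ∈ W, expect (piWeight w) (S u) ≤ b * (2 * α * p) := by
    refine (Finset.sum_le_sum fun u _ => hS1 u).trans ?_
    rw [Finset.sum_const, nsmul_eq_mul]
    gcongr
  have f3 : n * ((2 * β + (2 * α) ^ 2) * p ^ 2) ≤ c * (2 * β + (2 * α) ^ 2) * p := by
    have : (n : ℝ) * ((2 * β + (2 * α) ^ 2) * p ^ 2) = n * p * ((2 * β + (2 * α) ^ 2) * p) := by
      ring
    rw [this, mul_assoc c]
    gcongr
  linarith

end ClusterWeights

end RandomComplex

namespace RandomComplex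

/-! ### Which faces must be present or absent for a given tree to be seen -/

section ClusterEvents

variable {V : Type} {d : ℕ} [Fintype V] [DecidableEq V]

/-- The sets that have to be faces for the tree `C` to be seen from `t`. -/
def Cluster.present : ∀ {m}, (Fin d → V) → Cluster V d m → Finset (Finset V)
  | 0, _, _ => ∅
  | _ + 1, t, C => Finset.univ.biUnion fun v => (C v).elim ∅ fun f =>
      insert (insert v (verts t))
        (Finset.univ.biUnion fun i => Cluster.present (Function.update t i v) (f i))

/-- The sets that must not be faces for the tree `C` to be seen from `t`, entered from `W`. -/
def Cluster.absent : ∀ {m}, (Fin d → V) → Finset V → Cluster V d m → Finset (Finset V)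
  | 0, _, _, _ => ∅
  | _ + 1, t, W, C => Finset.univ.biUnion fun v =>
      (C v).elim (if v ∈ W then ∅ else {insert v (verts t)}) fun f =>
        Finset.univ.biUnion fun i =>
          Cluster.absent (Function.update t i v) (insert v (verts t)) (f i)

theorem Cluster.mem_present {m : ℕ} {t : Fin d → V} {C : Cluster V d (m + 1)} {s : Finset V} :
    s ∈ C.present t ↔ ∃ v f, C v = some f ∧
      (s = insert v (verts t) ∨ ∃ i, s ∈ (f i).present (Function.update t i v)) := by
  simp only [Cluster.present, Finset.mem_biUnion, Finset.mem_univ, true_and]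
  refine exists_congr fun v => ?_
  cases C v with
  | none => simp
  | some f => simp

theorem Cluster.mem_absent {m : ℕ} {t : Fin d → V} {W : Finset V} {C : Cluster V d (m + 1)}
    {s : Finset V} :
    s ∈ C.absent t W ↔ ∃ v, (C v = none ∧ v ∉ W ∧ s = insert v (verts t)) ∨
      ∃ f, C v = some f ∧
        ∃ i, s ∈ (f i).absent (Function.update t i v) (insert v (verts t)) := by
  simp only [Cluster.absent, Finset.mem_biUnion, Finset.mem_univ, true_and]
  refine exists_congr fun v => ?_
  cases C v with
  | none =>
    simp only [Option.elim]
    split_ifs with h <;> simp [h]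
  | some f => simp

/-- No label occurs twice in the tree. -/
def Cluster.Simple {m : ℕ} (C : Cluster V d m) : Prop := ∀ u, C.count u ≤ 1

theorem Cluster.count_some_le {m : ℕ} {C : Cluster V d (m + 1)} {v : V} {f : Fin d → Cluster V d m}
    (h : C v = some f) (u : V) :
    (if v = u then 1 else 0) + ∑ i, (f i).count u ≤ C.count u := by
  have key : ((C v).elim 0 fun f => (if v = u then 1 else 0) + ∑ i, Cluster.count u (f i)) ≤
      C.count u :=
    Finset.single_le_sum (f := fun v => (C v).elim 0 fun f =>
      (if v = u then 1 else 0) + ∑ i, Cluster.count u (f i)) (fun _ _ => Nat.zero_le _)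
      (Finset.mem_univ v)
  rwa [h] at key

theorem Cluster.count_some_add_le {m : ℕ} {C : Cluster V d (m + 1)} {v v' : V} (hv : v ≠ v')
    {f f' : Fin d → Cluster V d m} (h : C v = some f) (h' : C v' = some f') (u : V) :
    ((if v = u then 1 else 0) + ∑ i, (f i).count u) +
      ((if v' = u then 1 else 0) + ∑ i, (f' i).count u) ≤ C.count u := by
  have key : ((C v).elim 0 fun f => (if v = u then 1 else 0) + ∑ i, Cluster.count u (f i)) +
      ((C v').elim 0 fun f => (if v' = u then 1 else 0) + ∑ i, Cluster.count u (f i)) ≤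
      C.count u :=
    Finset.add_le_sum (f := fun v => (C v).elim 0 fun f =>
      (if v = u then 1 else 0) + ∑ i, Cluster.count u (f i)) (fun _ _ => Nat.zero_le _)
      (Finset.mem_univ v) (Finset.mem_univ v') hv
  rwa [h, h'] at key

theorem Cluster.count_child_le_sum {m : ℕ} (f : Fin d → Cluster V d m) (u : V) (i : Fin d) :
    (f i).count u ≤ ∑ i, (f i).count u :=
  Finset.single_le_sum (f := fun i => (f i).count u) (fun _ _ => Nat.zero_le _) (Finset.mem_univ i)

theorem Cluster.count_child_le {m : ℕ} {C : Cluster V d (m + 1)} {v : V}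
    {f : Fin d → Cluster V d m} (h : C v = some f) (u : V) (i : Fin d) :
    (f i).count u ≤ C.count u := by
  have h1 := Cluster.count_some_le h u
  have h2 := Cluster.count_child_le_sum f u i
  omega

theorem Cluster.count_label_pos {m : ℕ} {C : Cluster V d (m + 1)} {v : V}
    {f : Fin d → Cluster V d m} (h : C v = some f) : 0 < C.count v := by
  have h1 := Cluster.count_some_le h v
  rw [if_pos rfl] at h1
  omega

theorem Cluster.Simple.child {m : ℕ} {C : Cluster V d (m + 1)} (hC : C.Simple) {v : V}
    {f : Fin d → Cluster V d m} (h : C v = some f) (i : Fin d) : (f i).Simple := fun u =>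
  (Cluster.count_child_le h u i).trans (hC u)

theorem Cluster.Simple.count_label {m : ℕ} {C : Cluster V d (m + 1)} (hC : C.Simple) {v : V}
    {f : Fin d → Cluster V d m} (h : C v = some f) (i : Fin d) : (f i).count v = 0 := by
  have h1 := Cluster.count_some_le h v
  have h2 := Cluster.count_child_le_sum f v i
  have h3 := hC v
  rw [if_pos rfl] at h1
  omega

theorem Cluster.Simple.count_sibling {m : ℕ} {C : Cluster V d (m + 1)} (hC : C.Simple) {v : V}
    {f : Fin d → Cluster V d m} (h : C v = some f) {i j : Fin d} (hij : i ≠ j) {u : V}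
    (hu : 0 < (f i).count u) : (f j).count u = 0 := by
  have h1 := Cluster.count_some_le h u
  have h2 := Finset.add_le_sum (f := fun i => (f i).count u) (fun _ _ => Nat.zero_le _)
    (Finset.mem_univ i) (Finset.mem_univ j) hij
  have h3 := hC u
  omega

theorem Cluster.Simple.count_other {m : ℕ} {C : Cluster V d (m + 1)} (hC : C.Simple) {v v' : V}
    (hv : v ≠ v') {f f' : Fin d → Cluster V d m} (h : C v = some f) (h' : C v' = some f')
    (i : Fin d) {u : V} (hu : u = v' ∨ ∃ j, 0 < (f' j).count u) : (f i).count u = 0 := by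
  have h1 := Cluster.count_some_add_le hv h h' u
  have h2 := Cluster.count_child_le_sum f u i
  have h3 := hC u
  rcases hu with rfl | ⟨j, hj⟩
  · rw [if_pos (rfl : u = u)] at h1
    omega
  · have h4 := Cluster.count_child_le_sum f' u j
    omega

theorem Cluster.count_eq_zero_child {m : ℕ} {C : Cluster V d (m + 1)} (hC : C.Simple)
    {t : Fin d → V} {W : Finset V} (hW : verts t ⊆ W) (h0 : ∀ x ∈ W, C.count x = 0) {v : V}
    {f : Fin d → Cluster V d m} (h : C v = some f) (i : Fin d) :
    ∀ x ∈ insert v (verts t), (f i).count x = 0 := by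
  intro x hx
  rcases Finset.mem_insert.mp hx with rfl | hx
  · exact hC.count_label h i
  · have := Cluster.count_child_le h x i
    have := h0 x (hW hx)
    omega

theorem Cluster.label_not_mem {m : ℕ} {C : Cluster V d (m + 1)} {W : Finset V}
    (h0 : ∀ x ∈ W, C.count x = 0) {v : V} {f : Fin d → Cluster V d m} (h : C v = some f) :
    v ∉ W := fun hv => (Cluster.count_label_pos h).ne' (h0 v hv)

theorem Cluster.mem_of_mem_present {m : ℕ} {C : Cluster V d m} {t : Fin d → V} {s : Finset V}
    (hs : s ∈ C.present t) {x : V} (hx : x ∈ s) : x ∈ verts t ∨ 0 < C.count x := by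
  induction m generalizing t s with
  | zero => simp [Cluster.present] at hs
  | succ m ih =>
    obtain ⟨v, f, h, rfl | ⟨i, hi⟩⟩ := Cluster.mem_present.mp hs
    · rcases Finset.mem_insert.mp hx with rfl | hx
      · exact Or.inr (Cluster.count_label_pos h)
      · exact Or.inl hx
    · rcases ih hi hx with h1 | h1
      · rcases Finset.mem_insert.mp (verts_update_subset t i v h1) with rfl | h2
        · exact Or.inr (Cluster.count_label_pos h)
        · exact Or.inl h2
      · exact Or.inr (h1.trans_le (Cluster.count_child_le h x i))

theorem Cluster.exists_of_mem_absent {m : ℕ} {C : Cluster V d m} {t : Fin d → V} {W s : Finset V}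
    (hs : s ∈ C.absent t W) :
    (∃ y, y ∉ W ∧ s = insert y (verts t)) ∨ ∃ x ∈ s, 0 < C.count x := by
  induction m generalizing t s W with
  | zero => simp [Cluster.absent] at hs
  | succ m ih =>
    obtain ⟨v, ⟨-, h2, h3⟩ | ⟨f, h, i, hi⟩⟩ := Cluster.mem_absent.mp hs
    · exact Or.inl ⟨v, h2, h3⟩
    · right
      rcases ih hi with ⟨y, -, rfl⟩ | ⟨x, h1, h2⟩
      · exact ⟨v, Finset.mem_insert_of_mem (mem_verts_update_self t i v),
          Cluster.count_label_pos h⟩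
      · exact ⟨x, h1, h2.trans_le (Cluster.count_child_le h x i)⟩

/-- The vertex `t i` leaves the face on entering child `i` and cannot return as a label, since the
labels avoid `W`. Its presence thus distinguishes the sets of different branches. -/
theorem Cluster.dropped_not_mem {m : ℕ} {C : Cluster V d (m + 1)} {t : Fin d → V}
    (ht : Function.Injective t) {W : Finset V} (hW : verts t ⊆ W)
    (h0 : ∀ x ∈ W, C.count x = 0) {v : V} {f : Fin d → Cluster V d m} (h : C v = some f)
    {i : Fin d} {s : Finset V} (hs : s ∈ (f i).present (Function.update t i v)) : t i ∉ s := by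
  have hti : t i ∈ verts t := mem_verts.mpr ⟨i, rfl⟩
  intro hm
  rcases Cluster.mem_of_mem_present hs hm with h1 | h1
  · rcases (mem_verts_update ht).mp h1 with h2 | h2
    · exact Cluster.label_not_mem h0 h (hW (h2 ▸ hti))
    · exact h2.2 rfl
  · have := Cluster.count_child_le h (t i) i
    have := h0 _ (hW hti)
    omega

/-- Without repeated labels, no set can be required to be present at one place and absent at
another: a vertex of the set betrays where in the tree it arises. Only sets from the same child need
the induction hypothesis. -/
theorem Cluster.present_disjoint_absent {m : ℕ} {C : Cluster V d m} (hC : C.Simple) {t : Fin d → V}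
    (ht : Function.Injective t) {W : Finset V} (hW : verts t ⊆ W)
    (h0 : ∀ x ∈ W, C.count x = 0) {s : Finset V} (hs : s ∈ C.present t) : s ∉ C.absent t W := by
  induction m generalizing t W s with
  | zero => simp [Cluster.present] at hs
  | succ m ih =>
    intro ha
    obtain ⟨v, f, hv, hp⟩ := Cluster.mem_present.mp hs
    have hvW := Cluster.label_not_mem h0 hv
    have hvt : v ∉ verts t := fun h => hvW (hW h)
    obtain ⟨v', ⟨hn, hW', rfl⟩ | ⟨f', hv', i', hi'⟩⟩ := Cluster.mem_absent.mp ha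
    · rcases hp with e | ⟨i, hi⟩
      · obtain rfl : v' = v := insert_injOn (fun h => hW' (hW h)) e
        rw [hn] at hv
        cases hv
      · exact Cluster.dropped_not_mem ht hW h0 hv hi
          (Finset.mem_insert_of_mem (mem_verts.mpr ⟨i, rfl⟩))
    · have hvW' := Cluster.label_not_mem h0 hv'
      rcases hp with rfl | ⟨i, hi⟩
      · rcases Cluster.exists_of_mem_absent hi' with ⟨y, hy, e⟩ | ⟨x, hx, hpos⟩
        · rw [Finset.mem_insert, not_or] at hy
          have h1 : y ∈ insert v (verts t) := e ▸ Finset.mem_insert_self _ _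
          have h2 : v' ∈ insert v (verts t) :=
            e ▸ Finset.mem_insert_of_mem (mem_verts_update_self t i' v')
          have h3 := (Finset.mem_insert.mp h1).resolve_right hy.2
          have h4 := (Finset.mem_insert.mp h2).resolve_right fun h => hvW' (hW h)
          exact hy.1 (h3.trans h4.symm)
        · rcases Finset.mem_insert.mp hx with rfl | hx
          · by_cases hvv : v' = x
            · subst hvv
              exact hpos.ne' (hC.count_label hv' i')
            · exact hpos.ne' (hC.count_other hvv hv' hv i' (Or.inl rfl))
          · have := Cluster.count_child_le hv' x i'
            have := h0 x (hW hx)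
            omega
      · by_cases hvv : v = v'
        · subst hvv
          obtain rfl : f = f' := by rw [hv] at hv'; exact Option.some_inj.mp hv'
          by_cases hii : i = i'
          · subst hii
            exact ih (hC.child hv i) (injective_update ht hvt i) (verts_update_subset t i v)
              (Cluster.count_eq_zero_child hC hW h0 hv i) hi hi'
          · rcases Cluster.exists_of_mem_absent hi' with ⟨y, -, rfl⟩ | ⟨x, hx, hpos⟩
            · refine Cluster.dropped_not_mem ht hW h0 hv hi (Finset.mem_insert_of_mem ?_)
              rw [mem_verts_update ht]
              exact Or.inr ⟨mem_verts.mpr ⟨i, rfl⟩, fun e => hii (ht e)⟩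
            · rcases Cluster.mem_of_mem_present hi hx with h1 | h1
              · have := Cluster.count_eq_zero_child hC hW h0 hv i' x (verts_update_subset t i v h1)
                omega
              · have := hC.count_sibling hv hii h1
                omega
        · have key : ∃ x ∈ s, x ∉ insert v (verts t) ∧ (f i).count x = 0 := by
            rcases Cluster.exists_of_mem_absent hi' with ⟨y, -, rfl⟩ | ⟨x, hx, hpos⟩
            · refine ⟨v', Finset.mem_insert_of_mem (mem_verts_update_self t i' v'), ?_,
                hC.count_other hvv hv hv' i (Or.inl rfl)⟩
              rw [Finset.mem_insert]
              rintro (e | h)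
              · exact hvv e.symm
              · exact hvW' (hW h)
            · refine ⟨x, hx, ?_, hC.count_other hvv hv hv' i (Or.inr ⟨i', hpos⟩)⟩
              rw [Finset.mem_insert]
              rintro (rfl | h)
              · exact hpos.ne' (hC.count_other (Ne.symm hvv) hv' hv i' (Or.inl rfl))
              · have := Cluster.count_child_le hv' x i'
                have := h0 x (hW h)
                omega
          obtain ⟨x, hx, h1, h2⟩ := key
          rcases Cluster.mem_of_mem_present hi hx with h3 | h3
          · exact h1 (verts_update_subset t i v h3)
          · omega

theorem Cluster.card_of_mem {m : ℕ} {C : Cluster V d m} (hC : C.Simple) {t : Fin d → V}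
    (ht : Function.Injective t) {W : Finset V} (hW : verts t ⊆ W)
    (h0 : ∀ x ∈ W, C.count x = 0) {s : Finset V} (hs : s ∈ C.present t ∨ s ∈ C.absent t W) :
    s.card = d + 1 := by
  induction m generalizing t W s with
  | zero => simp [Cluster.present, Cluster.absent] at hs
  | succ m ih =>
    have hins : ∀ v, v ∉ W → (insert v (verts t)).card = d + 1 := fun v hv => by
      rw [Finset.card_insert_of_notMem fun h => hv (hW h), card_verts ht]
    have hch : ∀ v f, C v = some f → ∀ i, s ∈ (f i).present (Function.update t i v) ∨
        s ∈ (f i).absent (Function.update t i v) (insert v (verts t)) → s.card = d + 1 :=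
      fun v f hv i hi => ih (hC.child hv i)
        (injective_update ht (fun h => Cluster.label_not_mem h0 hv (hW h)) i)
        (verts_update_subset t i v) (Cluster.count_eq_zero_child hC hW h0 hv i) hi
    rcases hs with hs | hs
    · obtain ⟨v, f, hv, rfl | ⟨i, hi⟩⟩ := Cluster.mem_present.mp hs
      · exact hins v (Cluster.label_not_mem h0 hv)
      · exact hch v f hv i (Or.inl hi)
    · obtain ⟨v, ⟨-, h, rfl⟩ | ⟨f, hv, i, hi⟩⟩ := Cluster.mem_absent.mp hs
      · exact hins v h
      · exact hch v f hv i (Or.inr hi)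

/-- The prescribed sets answer every question the exploration asks; labels avoid the entrance sets,
so no prescribed branch is suppressed by the non-backtracking rule. -/
theorem Cluster.eq_clusterOf {m : ℕ} {C : Cluster V d m} (hC : C.Simple) {t : Fin d → V}
    {W : Finset V} (hW : verts t ⊆ W) (h0 : ∀ x ∈ W, C.count x = 0) {H : Set (Finset V)}
    (hp : ∀ s ∈ C.present t, s ∈ H) (ha : ∀ s ∈ C.absent t W, s ∉ H) : clusterOf H m t W = C := by
  induction m generalizing t W with
  | zero => rfl
  | succ m ih =>
    funext v
    cases hv : C v with
    | none =>
      refine if_neg fun h => ?_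
      exact ha _ (Cluster.mem_absent.mpr ⟨v, Or.inl ⟨hv, h.1, rfl⟩⟩) h.2
    | some f =>
      refine (if_pos ⟨Cluster.label_not_mem h0 hv,
        hp _ (Cluster.mem_present.mpr ⟨v, f, hv, Or.inl rfl⟩)⟩).trans ?_
      congr 1
      funext i
      exact ih (hC.child hv i) (verts_update_subset t i v)
        (Cluster.count_eq_zero_child hC hW h0 hv i)
        (fun s hs => hp s (Cluster.mem_present.mpr ⟨v, f, hv, Or.inr ⟨i, hs⟩⟩))
        (fun s hs => ha s (Cluster.mem_absent.mpr ⟨v, Or.inr ⟨f, hv, i, hs⟩⟩))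

theorem prod_pow_card_le_biUnion {ι κ : Type*} [DecidableEq κ] (s : Finset ι) (A : ι → Finset κ)
    {p : ℝ} (hp0 : 0 ≤ p) (hp1 : p ≤ 1) : ∏ i ∈ s, p ^ (A i).card ≤ p ^ (s.biUnion A).card := by
  rw [Finset.prod_pow_eq_pow_sum]
  exact pow_le_pow_of_le_one hp0 hp1 Finset.card_biUnion_le

/-- The tree pays a factor for each node, the event only for each distinct set, and nothing for
labels excluded by `W`. As all factors are at most 1, coincidences help, and no distinctness has to
be checked. -/
theorem Cluster.weight_le {p : ℝ} (hp0 : 0 ≤ p) (hp1 : p ≤ 1) {m : ℕ} (C : Cluster V d m)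
    (t : Fin d → V) (W : Finset V) :
    Cluster.weight p m C ≤ p ^ (C.present t).card * (1 - p) ^ (C.absent t W).card := by
  have hq0 : 0 ≤ 1 - p := by linarith
  have hq1 : 1 - p ≤ 1 := by linarith
  induction m generalizing t W with
  | zero => simp [Cluster.weight, Cluster.present, Cluster.absent]
  | succ m ih =>
    rw [Cluster.present, Cluster.absent]
    refine le_trans ?_ (mul_le_mul (prod_pow_card_le_biUnion _ _ hp0 hp1)
      (prod_pow_card_le_biUnion _ _ hq0 hq1) (Finset.prod_nonneg fun _ _ => by positivity)
      (by positivity))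
    rw [← Finset.prod_mul_distrib]
    refine Finset.prod_le_prod
      (fun v _ => optWeight_nonneg hp0 hp1 (Cluster.weight_nonneg hp0 hp1 m) _) fun v _ => ?_
    cases C v with
    | none =>
      simp only [Option.elim, optWeight, Finset.card_empty, pow_zero, one_mul]
      split_ifs
      · simpa using hp0
      · simp
    | some f =>
      simp only [Option.elim, optWeight]
      have h1 : p ^ (∑ i, ((f i).present (Function.update t i v)).card + 1) ≤
          p ^ (insert (insert v (verts t)) (Finset.univ.biUnion fun i =>
            (f i).present (Function.update t i v))).card :=
        pow_le_pow_of_le_one hp0 hp1 ((Finset.card_insert_le _ _).trans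
          (Nat.add_le_add_right Finset.card_biUnion_le 1))
      have h2 := prod_pow_card_le_biUnion Finset.univ (fun i =>
        (f i).absent (Function.update t i v) (insert v (verts t))) hq0 hq1
      refine le_trans ?_ (mul_le_mul h1 h2 (Finset.prod_nonneg fun _ _ => by positivity)
        (by positivity))
      rw [pow_succ', mul_assoc, ← Finset.prod_pow_eq_pow_sum, ← Finset.prod_mul_distrib]
      refine mul_le_mul_of_nonneg_left ?_ hp0
      exact Finset.prod_le_prod (fun i _ => Cluster.weight_nonneg hp0 hp1 m _)
        fun i _ => ih (f i) _ _

end ClusterEvents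

end RandomComplex

namespace RandomComplex

/-! ### Comparing random faces with independent trees; second moment and concentration -/

section RandomFaces

open MeasureTheory ProbabilityTheory

theorem setBernoulli_real_cylinder {ι : Type*} [DecidableEq ι] {u : Set ι} (p : unitInterval)
    {P A : Finset ι} (hPA : Disjoint P A) (hP : ∀ i ∈ P, i ∈ u) (hA : ∀ i ∈ A, i ∈ u) :
    (setBernoulli u p).real {S | (∀ i ∈ P, i ∈ S) ∧ ∀ i ∈ A, i ∉ S} =
      (p : ℝ) ^ P.card * (1 - p) ^ A.card := by
  have hpre : (fun q : ι → Prop => {i | q i}) ⁻¹' {S | (∀ i ∈ P, i ∈ S) ∧ ∀ i ∈ A, i ∉ S} =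
      Set.pi ((P ∪ A : Finset ι) : Set ι) fun i => if i ∈ P then {True} else {False} := by
    ext q
    simp only [Set.mem_preimage, Set.mem_ofPred_eq, Set.mem_pi, Finset.coe_union, Set.mem_union,
      Finset.mem_coe]
    constructor
    · rintro ⟨h1, h2⟩ i hi
      by_cases h : i ∈ P
      · simpa [h] using h1 i h
      · simpa [h] using h2 i (hi.resolve_left h)
    · intro h
      refine ⟨fun i hi => ?_, fun i hi => ?_⟩
      · simpa [hi] using h i (Or.inl hi)
      · have hn : i ∉ P := fun h' => Finset.disjoint_left.mp hPA h' hi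
        simpa [hn] using h i (Or.inr hi)
  rw [measureReal_def, setBernoulli_apply', hpre, Measure.infinitePi_pi _ (by measurability),
    Finset.prod_union hPA, ENNReal.toReal_mul, ENNReal.toReal_prod, ENNReal.toReal_prod]
  congr 1
  · rw [Finset.prod_congr rfl (g := fun _ => (p : ℝ)), Finset.prod_const]
    intro i hi
    simp [hi, hP i hi]
  · rw [Finset.prod_congr rfl (g := fun _ => (1 - p : ℝ)), Finset.prod_const]
    intro i hi
    have hn : i ∉ P := fun h' => Finset.disjoint_left.mp hPA h' hi
    simp [hn, hA i hi]

/-- The probability that the random family of `d`-faces is `S`. -/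
noncomputable def faceWeight (d n : ℕ) (p : unitInterval) (S : Set (Finset (Fin n))) : ℝ :=
  (setBernoulli {σ : Finset (Fin n) | σ.card = d + 1} p).real {S}

theorem faceWeight_nonneg (d n : ℕ) (p : unitInterval) (S : Set (Finset (Fin n))) :
    0 ≤ faceWeight d n p S := measureReal_nonneg

open Classical in
theorem setBernoulli_real_eq_expect (d n : ℕ) (p : unitInterval)
    (E : Set (Set (Finset (Fin n)))) :
    (setBernoulli {σ : Finset (Fin n) | σ.card = d + 1} p).real E =
      expect (faceWeight d n p) fun S => if S ∈ E then 1 else 0 := by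
  have := sum_measureReal_singleton
    (μ := setBernoulli {σ : Finset (Fin n) | σ.card = d + 1} p) E.toFinset
  rw [Set.coe_toFinset] at this
  rw [← this, expect]
  simp only [mul_ite, mul_one, mul_zero, faceWeight]
  rw [← Finset.sum_filter]
  congr 1
  ext S
  simp

theorem sum_faceWeight (d n : ℕ) (p : unitInterval) : ∑ S, faceWeight d n p S = 1 := by
  have := setBernoulli_real_eq_expect d n p Set.univ
  simpa [expect] using this.symm

open Classical in
-- One-sided domination on the good set suffices: |q - w| ≤ (q - w) + 2w·1_bad, and the first term
-- sums to zero since both weights have total mass one.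
theorem abs_expect_sub_expect_le {β : Type*} [Fintype β] {q w : β → ℝ} {good : β → Prop}
    (hq0 : ∀ b, 0 ≤ q b) (hw0 : ∀ b, 0 ≤ w b) (hq : ∑ b, q b = 1) (hw : ∑ b, w b = 1)
    (h : ∀ b, good b → w b ≤ q b) {G : β → ℝ} {K : ℝ} (hG : ∀ b, |G b| ≤ K) :
    |expect q G - expect w G| ≤ 2 * K * expect w fun b => if good b then 0 else 1 := by
  have hb : ∀ b, |q b - w b| ≤ (q b - w b) + 2 * (w b * if good b then 0 else 1) := by
    intro b
    split_ifs with hg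
    · rw [abs_of_nonneg (by linarith [h b hg])]
      linarith
    · rw [abs_le]
      constructor <;> linarith [hq0 b, hw0 b]
  have hsum : ∑ b, |q b - w b| ≤ 2 * expect w fun b => if good b then 0 else 1 := by
    refine (Finset.sum_le_sum fun b _ => hb b).trans ?_
    rw [Finset.sum_add_distrib, Finset.sum_sub_distrib, hq, hw, ← Finset.mul_sum]
    simp [expect]
  have : expect q G - expect w G = ∑ b, (q b - w b) * G b := by
    simp only [expect, ← Finset.sum_sub_distrib, sub_mul]
  rw [this]
  calc |∑ b, (q b - w b) * G b| ≤ ∑ b, |(q b - w b) * G b| := Finset.abs_sum_le_sum_abs _ _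
    _ ≤ ∑ b, |q b - w b| * K := by
        refine Finset.sum_le_sum fun b _ => ?_
        rw [abs_mul]
        exact mul_le_mul_of_nonneg_left (hG b) (abs_nonneg _)
    _ = (∑ b, |q b - w b|) * K := by rw [Finset.sum_mul]
    _ ≤ (2 * expect w fun b => if good b then 0 else 1) * K := by
        rcases isEmpty_or_nonempty β with h0 | ⟨⟨b⟩⟩
        · simp [expect]
        · exact mul_le_mul_of_nonneg_right hsum ((abs_nonneg _).trans (hG b))
    _ = _ := by ring

/-- The members of `S` of dimension `d`. -/
def facesOf {V : Type*} (d : ℕ) (S : Set (Finset V)) : Set (Finset V) :=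
  {σ | σ ∈ S ∧ σ.card = d + 1}

/-- Separation makes all presence and absence requirements of the two trees compatible, so they
define a cylinder event whose probability is a product of powers of p and 1 - p, at least the tree
weight. -/
theorem weight_le_prob_clusters {d n m : ℕ} (hd : 0 < d) (p : unitInterval)
    {t : Fin 2 → Fin d → Fin n} (ht : ∀ a, Function.Injective (t a))
    (hdisj : Disjoint (verts (t 0)) (verts (t 1))) {x : Fin 2 → Cluster (Fin n) d m}
    (hx : Separated (verts (t 0) ∪ verts (t 1)) x) :
    piWeight (Cluster.weight (p : ℝ) m) x ≤
      (setBernoulli {σ : Finset (Fin n) | σ.card = d + 1} p).real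
        {S | (fun a => clusterOf (facesOf d S) m (t a) (verts (t a))) = x} := by
  have hle : ∀ a u, (x a).count u ≤ ∑ a, (x a).count u := fun a u =>
    Finset.single_le_sum (f := fun a => (x a).count u) (fun _ _ => Nat.zero_le _)
      (Finset.mem_univ a)
  have hsimple : ∀ a, (x a).Simple := fun a u => (hle a u).trans (hx u).1
  have hsub : ∀ a, verts (t a) ⊆ verts (t 0) ∪ verts (t 1) := by
    intro a
    fin_cases a
    · exact Finset.subset_union_left
    · exact Finset.subset_union_right
  have hzero : ∀ a b, ∀ y ∈ verts (t b), (x a).count y = 0 := fun a b y hy => by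
    have h1 := hle a y
    have h2 := (hx y).2 (hsub b hy)
    omega
  have hdis : ∀ a b, a ≠ b → Disjoint (verts (t a)) (verts (t b)) := by
    intro a b hab
    fin_cases a <;> fin_cases b
    · exact absurd rfl hab
    · exact hdisj
    · exact hdisj.symm
    · exact absurd rfl hab
  have hpa : ∀ a b, ∀ s ∈ (x a).present (t a), s ∉ (x b).absent (t b) (verts (t b)) := by
    intro a b s hs hs'
    by_cases hab : a = b
    · subst hab
      exact Cluster.present_disjoint_absent (hsimple a) (ht a) subset_rfl (hzero a a) hs hs'
    · have hkey : ∃ y ∈ s, y ∉ verts (t a) ∧ (x a).count y = 0 := by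
        rcases Cluster.exists_of_mem_absent hs' with ⟨y, -, rfl⟩ | ⟨y, hy, hpos⟩
        · have hv : t b ⟨0, hd⟩ ∈ verts (t b) := mem_verts.mpr ⟨_, rfl⟩
          exact ⟨t b ⟨0, hd⟩, Finset.mem_insert_of_mem hv,
            Finset.disjoint_right.mp (hdis a b hab) hv, hzero a b _ hv⟩
        · refine ⟨y, hy, fun h => hpos.ne' (hzero b a y h), ?_⟩
          have h1 := (hx y).1
          have h2 := Finset.add_le_sum (f := fun a => (x a).count y) (fun _ _ => Nat.zero_le _)
            (Finset.mem_univ a) (Finset.mem_univ b) hab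
          omega
      obtain ⟨y, hy, h1, h2⟩ := hkey
      rcases Cluster.mem_of_mem_present hs hy with h3 | h3
      · exact h1 h3
      · omega
  let P : Finset (Finset (Fin n)) := Finset.univ.biUnion fun a => (x a).present (t a)
  let A : Finset (Finset (Fin n)) :=
    Finset.univ.biUnion fun a => (x a).absent (t a) (verts (t a))
  have hPA : Disjoint P A := by
    rw [Finset.disjoint_left]
    intro s hs hs'
    obtain ⟨a, -, ha⟩ := Finset.mem_biUnion.mp hs
    obtain ⟨b, -, hb⟩ := Finset.mem_biUnion.mp hs'
    exact hpa a b s ha hb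
  have hcard : ∀ a s, s ∈ (x a).present (t a) ∨ s ∈ (x a).absent (t a) (verts (t a)) →
      s.card = d + 1 := fun a s hs =>
    Cluster.card_of_mem (hsimple a) (ht a) subset_rfl (hzero a a) hs
  have hP : ∀ s ∈ P, s ∈ {σ : Finset (Fin n) | σ.card = d + 1} := fun s hs => by
    obtain ⟨a, -, ha⟩ := Finset.mem_biUnion.mp hs
    exact hcard a s (Or.inl ha)
  have hA : ∀ s ∈ A, s ∈ {σ : Finset (Fin n) | σ.card = d + 1} := fun s hs => by
    obtain ⟨a, -, ha⟩ := Finset.mem_biUnion.mp hs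
    exact hcard a s (Or.inr ha)
  have hp0 : (0 : ℝ) ≤ p := p.2.1
  have hp1 : (p : ℝ) ≤ 1 := p.2.2
  have hq0 : (0 : ℝ) ≤ 1 - p := by linarith
  have hq1 : (1 : ℝ) - p ≤ 1 := by linarith
  calc piWeight (Cluster.weight (p : ℝ) m) x
      ≤ ∏ a, ((p : ℝ) ^ ((x a).present (t a)).card *
          (1 - p) ^ ((x a).absent (t a) (verts (t a))).card) :=
        Finset.prod_le_prod (fun a _ => Cluster.weight_nonneg hp0 hp1 m _)
          fun a _ => Cluster.weight_le hp0 hp1 _ _ _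
    _ ≤ (p : ℝ) ^ P.card * (1 - p) ^ A.card := by
        rw [Finset.prod_mul_distrib]
        exact mul_le_mul (prod_pow_card_le_biUnion _ _ hp0 hp1)
          (prod_pow_card_le_biUnion _ _ hq0 hq1) (Finset.prod_nonneg fun _ _ => by positivity)
          (by positivity)
    _ = _ := (setBernoulli_real_cylinder p hPA hP hA).symm
    _ ≤ _ := by
        refine measureReal_mono ?_ (measure_ne_top _ _)
        rintro S ⟨h1, h2⟩
        funext a
        refine Cluster.eq_clusterOf (hsimple a) subset_rfl (hzero a a) (fun s hs => ?_)
          fun s hs hs' => ?_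
        · exact ⟨h1 s (Finset.mem_biUnion.mpr ⟨a, Finset.mem_univ a, hs⟩), hcard a s (Or.inl hs)⟩
        · exact h2 s (Finset.mem_biUnion.mpr ⟨a, Finset.mem_univ a, hs⟩) hs'.1

/-- Domination on separated pairs and the O(p) weight of the others bound the distance between the
two laws, uniformly in the bounded test function. -/
theorem exists_pair_bound {d : ℕ} (hd : 0 < d) {c : ℝ} (hc : 0 ≤ c) (m : ℕ) :
    ∃ γ : ℝ, 0 ≤ γ ∧ ∀ (n : ℕ) (p : unitInterval), n * (p : ℝ) ≤ c →
      ∀ t : Fin 2 → Fin d → Fin n, (∀ a, Function.Injective (t a)) →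
      Disjoint (verts (t 0)) (verts (t 1)) →
      ∀ (G : (Fin 2 → Cluster (Fin n) d m) → ℝ) (K : ℝ), (∀ x, |G x| ≤ K) →
      |expect (faceWeight d n p)
          (fun S => G fun a => clusterOf (facesOf d S) m (t a) (verts (t a))) -
        expect (piWeight (Cluster.weight (p : ℝ) m)) G| ≤ K * (γ * p) := by
  classical
  obtain ⟨γ, hγ, h⟩ := exists_not_separated_bound d hc m (2 * d)
  refine ⟨2 * γ, by positivity, fun n p hnp t ht hdisj G K hG => ?_⟩
  let X : Set (Finset (Fin n)) → Fin 2 → Cluster (Fin n) d m :=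
    fun S a => clusterOf (facesOf d S) m (t a) (verts (t a))
  let q : (Fin 2 → Cluster (Fin n) d m) → ℝ := fun x =>
    expect (faceWeight d n p) fun S => if X S = x then 1 else 0
  have hswap : ∀ G : (Fin 2 → Cluster (Fin n) d m) → ℝ,
      expect (faceWeight d n p) (fun S => G (X S)) = expect q G := by
    intro G
    simp only [expect, q, Finset.sum_mul]
    rw [Finset.sum_comm]
    refine Finset.sum_congr rfl fun S _ => ?_
    simp
  have hq0 : ∀ x, 0 ≤ q x := fun x =>
    expect_nonneg (faceWeight_nonneg d n p) fun S => by split_ifs <;> norm_num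
  have hq1 : ∑ x, q x = 1 := by
    have := hswap fun _ => 1
    rw [expect_const (sum_faceWeight d n p)] at this
    simpa [expect] using this.symm
  have hp0 : (0 : ℝ) ≤ p := p.2.1
  have hp1 : (p : ℝ) ≤ 1 := p.2.2
  have hw : ∀ x, Separated (verts (t 0) ∪ verts (t 1)) x →
      piWeight (Cluster.weight (p : ℝ) m) x ≤ q x := by
    intro x hx
    refine (weight_le_prob_clusters hd p ht hdisj hx).trans_eq ?_
    rw [setBernoulli_real_eq_expect]
    refine congrArg _ (funext fun S => ?_)
    split_ifs with h1 h2 h2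
    exacts [rfl, absurd h1 h2, absurd h2 h1, rfl]
  have hcardW : (verts (t 0) ∪ verts (t 1)).card ≤ 2 * d := by
    refine (Finset.card_union_le _ _).trans ?_
    rw [card_verts (ht 0), card_verts (ht 1)]
    omega
  have hw1 : ∑ x : Fin 2 → Cluster (Fin n) d m, piWeight (Cluster.weight (p : ℝ) m) x = 1 :=
    sum_piWeight (Cluster.sum_weight (p : ℝ) m)
  have hK : 0 ≤ K := by
    rcases isEmpty_or_nonempty (Fin 2 → Cluster (Fin n) d m) with h0 | ⟨⟨x⟩⟩
    · simp at hw1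
    · exact (abs_nonneg _).trans (hG x)
  have h1 := abs_expect_sub_expect_le hq0 (piWeight_nonneg (Cluster.weight_nonneg hp0 hp1 m)) hq1
    hw1 hw hG
  rw [← hswap] at h1
  refine h1.trans ?_
  have h2 := h n p hp0 hp1 hnp _ hcardW
  calc _ ≤ 2 * K * (γ * p) := mul_le_mul_of_nonneg_left h2 (by positivity)
    _ = _ := by ring

/-- Some vertex of `τ` must be shared, and each vertex lies in a fraction d/n of the `d`-sets; so at
most a fraction d²/n of them meets `τ`. -/
theorem card_filter_not_disjoint_le {n d : ℕ} (hd : 0 < d) {τ : Finset (Fin n)}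
    (hτ : τ.card = d) :
    n * ((Finset.powersetCard d (Finset.univ : Finset (Fin n))).filter
      fun τ' => ¬ Disjoint τ τ').card ≤ d ^ 2 * n.choose d := by
  obtain ⟨d, rfl⟩ : ∃ e, d = e + 1 := ⟨d - 1, by omega⟩
  have hn : 0 < n := by
    obtain ⟨v, -⟩ := Finset.card_pos.mp (by omega : 0 < τ.card)
    exact v.pos
  obtain ⟨n, rfl⟩ : ∃ e, n = e + 1 := ⟨n - 1, by omega⟩
  have h1 : ∀ v : Fin (n + 1), ((Finset.powersetCard (d + 1) Finset.univ).filter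
      fun τ' : Finset (Fin (n + 1)) => v ∈ τ').card ≤ n.choose d := by
    intro v
    have : (Finset.powersetCard d (Finset.univ.erase v)).card = n.choose d := by
      rw [Finset.card_powersetCard, Finset.card_erase_of_mem (Finset.mem_univ v),
        Finset.card_univ, Fintype.card_fin, Nat.add_sub_cancel]
    rw [← this]
    refine Finset.card_le_card_of_injOn (fun τ' => τ'.erase v) ?_ ?_
    · intro τ' h
      simp only [Finset.coe_filter, Finset.mem_powersetCard_univ, Set.mem_ofPred_eq] at h
      rw [Finset.mem_coe, Finset.mem_powersetCard]
      exact ⟨Finset.erase_subset_erase _ (Finset.subset_univ _), by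
        rw [Finset.card_erase_of_mem h.2, h.1, Nat.add_sub_cancel]⟩
    · intro a ha b hb hab
      simp only [Finset.coe_filter, Finset.mem_powersetCard_univ, Set.mem_ofPred_eq] at ha hb
      rw [← Finset.insert_erase ha.2, ← Finset.insert_erase hb.2]
      exact congrArg _ hab
  have h2 : ((Finset.powersetCard (d + 1) (Finset.univ : Finset (Fin (n + 1)))).filter
      fun τ' => ¬ Disjoint τ τ').card ≤ (d + 1) * n.choose d := by
    have hsub : ((Finset.powersetCard (d + 1) (Finset.univ : Finset (Fin (n + 1)))).filter
        fun τ' => ¬ Disjoint τ τ') ⊆ τ.biUnion fun v =>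
          (Finset.powersetCard (d + 1) Finset.univ).filter fun τ' => v ∈ τ' := by
      intro τ' h
      rw [Finset.mem_filter, Finset.not_disjoint_iff] at h
      obtain ⟨h3, v, h4, h5⟩ := h
      exact Finset.mem_biUnion.mpr ⟨v, h4, Finset.mem_filter.mpr ⟨h3, h5⟩⟩
    refine (Finset.card_le_card hsub).trans (Finset.card_biUnion_le.trans ?_)
    refine (Finset.sum_le_sum fun v _ => h1 v).trans_eq ?_
    rw [Finset.sum_const, hτ, smul_eq_mul]
  have h3 := Nat.add_one_mul_choose_eq n d
  calc (n + 1) * _ ≤ (n + 1) * ((d + 1) * n.choose d) := Nat.mul_le_mul_left _ h2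
    _ = (d + 1) * ((n + 1) * n.choose d) := by ring
    _ = (d + 1) ^ 2 * (n + 1).choose (d + 1) := by rw [h3]; ring

/-- For disjoint faces the centred product has expectation zero under independent trees, hence
O(1/n) in truth. Intersecting pairs are bounded trivially, and form only an O(1/n) fraction. -/
theorem exists_second_moment_bound {d : ℕ} (hd : 0 < d) {c : ℝ} (hc : 0 ≤ c) (m : ℕ) :
    ∃ Γ : ℝ, 0 ≤ Γ ∧ ∀ (n : ℕ) (p : unitInterval), 0 < n → n * (p : ℝ) ≤ c →
      ∀ r : Finset (Fin n) → Fin d → Fin n,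
      (∀ τ, τ.card = d → Function.Injective (r τ) ∧ verts (r τ) = τ) →
      ∀ (g : Cluster (Fin n) d m → ℝ) (K : ℝ), (∀ C, |g C| ≤ K) →
      expect (faceWeight d n p) (fun S =>
        (∑ τ ∈ Finset.powersetCard d Finset.univ,
          (g (clusterOf (facesOf d S) m (r τ) τ) - expect (Cluster.weight (p : ℝ) m) g)) ^ 2) ≤
        Γ * K ^ 2 / n * (n.choose d : ℝ) ^ 2 := by
  classical
  obtain ⟨γ, hγ, h⟩ := exists_pair_bound hd hc m
  -- The factor 4 bounds the product of two deviations, each at most 2K; γc comes from disjoint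
  -- pairs and d² from intersecting ones.
  refine ⟨4 * γ * c + 4 * d ^ 2, by positivity, fun n p hn hnp r hr g K hg => ?_⟩
  have hp0 : (0 : ℝ) ≤ p := p.2.1
  have hp1 : (p : ℝ) ≤ 1 := p.2.2
  have hn0 : (0 : ℝ) < n := by exact_mod_cast hn
  set w := Cluster.weight (V := Fin n) (d := d) (p : ℝ) m with hw
  have hw0 : ∀ C, 0 ≤ w C := Cluster.weight_nonneg hp0 hp1 m
  have hw1 : ∑ C, w C = 1 := Cluster.sum_weight (p : ℝ) m
  set μ := expect w g with hμ
  have hμK : |μ| ≤ K := by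
    rw [abs_le]
    constructor
    · rw [← expect_const hw1 (-K)]
      exact expect_mono hw0 fun C => (abs_le.mp (hg C)).1
    · rw [← expect_const hw1 K]
      exact expect_mono hw0 fun C => (abs_le.mp (hg C)).2
  have hdev : ∀ C, |g C - μ| ≤ 2 * K := fun C => by
    have := abs_sub (g C) μ
    linarith [hg C]
  have hprod : ∀ C C', |(g C - μ) * (g C' - μ)| ≤ 4 * K ^ 2 := fun C C' => by
    rw [abs_mul]
    calc _ ≤ (2 * K) * (2 * K) := mul_le_mul (hdev C) (hdev C') (abs_nonneg _)
          ((abs_nonneg _).trans (hdev C))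
      _ = _ := by ring
  let Y : Finset (Fin n) → Set (Finset (Fin n)) → ℝ := fun τ S =>
    g (clusterOf (facesOf d S) m (r τ) τ) - μ
  have hdisj : ∀ τ τ' : Finset (Fin n), τ.card = d → τ'.card = d → Disjoint τ τ' →
      expect (faceWeight d n p) (fun S => Y τ S * Y τ' S) ≤ 4 * K ^ 2 * (γ * (c / n)) := by
    intro τ τ' hτ hτ' hdis
    have h0 : verts (r τ) = τ := (hr τ hτ).2
    have h1 : verts (r τ') = τ' := (hr τ' hτ').2
    have hb := h n p hnp ![r τ, r τ'] (by
        intro a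
        fin_cases a
        · exact (hr τ hτ).1
        · exact (hr τ' hτ').1)
      (by simpa [h0, h1] using hdis)
      (fun x => (g (x 0) - μ) * (g (x 1) - μ)) (4 * K ^ 2) fun x => hprod _ _
    have hz : expect (piWeight w) (fun x : Fin 2 → Cluster (Fin n) d m =>
        (g (x 0) - μ) * (g (x 1) - μ)) = 0 := by
      have := expect_piWeight_eval_mul hw1 (i := (0 : Fin 2)) (j := 1) (by decide)
        (fun C => g C - μ) (fun C => g C - μ)
      rw [this, expect_sub, expect_const hw1]
      simp [hμ]
    rw [hz, sub_zero] at hb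
    have hb' := (abs_le.mp hb).2
    simp only [Matrix.cons_val_zero, Matrix.cons_val_one, h0, h1] at hb'
    refine hb'.trans ?_
    have : (p : ℝ) ≤ c / n := by
      rw [le_div_iff₀ hn0]
      linarith
    gcongr
  have hany : ∀ τ τ' : Finset (Fin n),
      expect (faceWeight d n p) (fun S => Y τ S * Y τ' S) ≤ 4 * K ^ 2 := by
    intro τ τ'
    refine (expect_mono (faceWeight_nonneg d n p)
      fun S => (abs_le.mp (hprod _ _)).2).trans_eq ?_
    exact expect_const (sum_faceWeight d n p) _
  have hrow : ∀ τ ∈ Finset.powersetCard d (Finset.univ : Finset (Fin n)),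
      ∑ τ' ∈ Finset.powersetCard d (Finset.univ : Finset (Fin n)),
        expect (faceWeight d n p) (fun S => Y τ S * Y τ' S) ≤
      (n.choose d : ℝ) * (4 * K ^ 2 * (γ * (c / n))) +
        d ^ 2 * n.choose d / n * (4 * K ^ 2) := by
    intro τ hτ
    rw [Finset.mem_powersetCard_univ] at hτ
    have hcount := card_filter_not_disjoint_le hd hτ
    have hcount' : (((Finset.powersetCard d (Finset.univ : Finset (Fin n))).filter
        fun τ' => ¬ Disjoint τ τ').card : ℝ) ≤ d ^ 2 * n.choose d / n := by
      rw [le_div_iff₀ hn0, mul_comm]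
      exact_mod_cast hcount
    have hle : ∀ τ' ∈ Finset.powersetCard d (Finset.univ : Finset (Fin n)),
        expect (faceWeight d n p) (fun S => Y τ S * Y τ' S) ≤
        4 * K ^ 2 * (γ * (c / n)) + if ¬ Disjoint τ τ' then 4 * K ^ 2 else 0 := by
      intro τ' hτ'
      rw [Finset.mem_powersetCard_univ] at hτ'
      split_ifs with hdis
      · rw [add_zero]
        exact hdisj τ τ' hτ hτ' hdis
      · have := hany τ τ'
        have : 0 ≤ 4 * K ^ 2 * (γ * (c / n)) := by positivity
        linarith
    refine (Finset.sum_le_sum hle).trans ?_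
    rw [Finset.sum_add_distrib, Finset.sum_const, Finset.card_powersetCard, Finset.card_univ,
      Fintype.card_fin, nsmul_eq_mul, ← Finset.sum_filter, Finset.sum_const, nsmul_eq_mul]
    gcongr
  have hexp : expect (faceWeight d n p) (fun S =>
      (∑ τ ∈ Finset.powersetCard d Finset.univ, Y τ S) ^ 2) =
      ∑ τ ∈ Finset.powersetCard d (Finset.univ : Finset (Fin n)),
        ∑ τ' ∈ Finset.powersetCard d (Finset.univ : Finset (Fin n)),
          expect (faceWeight d n p) (fun S => Y τ S * Y τ' S) := by
    simp only [sq, Finset.sum_mul_sum, expect_sum]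
  change expect (faceWeight d n p) (fun S =>
      (∑ τ ∈ Finset.powersetCard d Finset.univ, Y τ S) ^ 2) ≤ _
  rw [hexp]
  refine (Finset.sum_le_sum hrow).trans_eq ?_
  rw [Finset.sum_const, Finset.card_powersetCard, Finset.card_univ, Fintype.card_fin,
    nsmul_eq_mul]
  field_simp

/-- Chebyshev's inequality for the sum of a bounded local function over all `(d-1)`-faces. -/
theorem exists_concentration_bound {d : ℕ} (hd : 0 < d) {c : ℝ} (hc : 0 ≤ c) (m : ℕ) :
    ∃ Γ : ℝ, 0 ≤ Γ ∧ ∀ (n : ℕ) (p : unitInterval), d ≤ n → n * (p : ℝ) ≤ c →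
      ∀ r : Finset (Fin n) → Fin d → Fin n,
      (∀ τ, τ.card = d → Function.Injective (r τ) ∧ verts (r τ) = τ) →
      ∀ (g : Cluster (Fin n) d m → ℝ) (K : ℝ), (∀ C, |g C| ≤ K) → ∀ ε : ℝ, 0 < ε →
      (setBernoulli {σ : Finset (Fin n) | σ.card = d + 1} p).real {S | ε * n.choose d ≤
        |∑ τ ∈ Finset.powersetCard d Finset.univ, g (clusterOf (facesOf d S) m (r τ) τ) -
          n.choose d * expect (Cluster.weight (p : ℝ) m) g|} ≤ Γ * K ^ 2 / ε ^ 2 / n := by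
  classical
  obtain ⟨Γ, hΓ, h⟩ := exists_second_moment_bound hd hc m
  refine ⟨Γ, hΓ, fun n p hn hnp r hr g K hg ε hε => ?_⟩
  have hN : (0 : ℝ) < n.choose d := by exact_mod_cast Nat.choose_pos hn
  have hm := h n p (by omega) hnp r hr g K hg
  have hsum : ∀ S, ∑ τ ∈ Finset.powersetCard d Finset.univ,
      (g (clusterOf (facesOf d S) m (r τ) τ) - expect (Cluster.weight (p : ℝ) m) g) =
      ∑ τ ∈ Finset.powersetCard d Finset.univ, g (clusterOf (facesOf d S) m (r τ) τ) -
          n.choose d * expect (Cluster.weight (p : ℝ) m) g := by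
    intro S
    rw [Finset.sum_sub_distrib, Finset.sum_const, Finset.card_powersetCard, Finset.card_univ,
      Fintype.card_fin, nsmul_eq_mul]
  simp only [hsum] at hm
  rw [setBernoulli_real_eq_expect]
  have hpos : 0 < (ε * n.choose d) ^ 2 := by positivity
  have hmark : (ε * n.choose d) ^ 2 * expect (faceWeight d n p) (fun S =>
      if S ∈ {S | ε * n.choose d ≤
        |∑ τ ∈ Finset.powersetCard d Finset.univ, g (clusterOf (facesOf d S) m (r τ) τ) -
          n.choose d * expect (Cluster.weight (p : ℝ) m) g|} then (1 : ℝ) else 0) ≤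
      Γ * K ^ 2 / n * (n.choose d : ℝ) ^ 2 := by
    rw [← expect_const_mul]
    refine (expect_mono (faceWeight_nonneg d n p) fun S => ?_).trans hm
    split_ifs with hS
    · rw [mul_one, ← sq_abs (∑ τ ∈ _, _ - _)]
      exact pow_le_pow_left₀ (by positivity) hS 2
    · rw [mul_zero]
      positivity
  rw [mul_comm, ← le_div_iff₀ hpos] at hmark
  refine hmark.trans_eq ?_
  field_simp

theorem exists_enumeration {n d : ℕ} (hn : 0 < n) : ∃ r : Finset (Fin n) → Fin d → Fin n,
    ∀ τ, τ.card = d → Function.Injective (r τ) ∧ verts (r τ) = τ := by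
  have : ∀ τ : Finset (Fin n), ∃ t : Fin d → Fin n,
      τ.card = d → Function.Injective t ∧ verts t = τ := by
    intro τ
    by_cases h : τ.card = d
    · refine ⟨τ.orderEmbOfFin h, fun _ => ⟨(τ.orderEmbOfFin h).injective, ?_⟩⟩
      ext v
      rw [mem_verts]
      have := Finset.range_orderEmbOfFin τ h
      rw [← Finset.mem_coe, ← this]
      rfl
    · exact ⟨fun _ => ⟨0, hn⟩, fun h' => absurd h' h⟩
  choose r hr using this
  exact ⟨r, hr⟩

end RandomFaces

end RandomComplex

namespace RandomComplex

/-! ### Counting successes among independent coordinates -/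

section Binomial

open Classical in
/-- The number of coordinates with property `X`. -/
noncomputable def hits {ι β : Type*} [Fintype ι] (X : β → Prop) (x : ι → β) : ℕ :=
  (Finset.univ.filter fun i => X (x i)).card

theorem hits_eq_zero_iff {ι β : Type*} [Fintype ι] (X : β → Prop) (x : ι → β) :
    hits X x = 0 ↔ ∀ i, ¬ X (x i) := by
  simp [hits, Finset.filter_eq_empty_iff]

theorem hits_eq_sum {ι β : Type*} [Fintype ι] (X : β → Prop) [DecidablePred X] (x : ι → β) :
    (hits X x : ℝ) = ∑ i, if X (x i) then (1 : ℝ) else 0 := by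
  rw [Finset.sum_boole, hits]
  congr!

variable {ι β : Type*} [Fintype ι] [DecidableEq ι] [Fintype β]

open Classical in
/-- The probability of `X`. -/
noncomputable def chance (w : β → ℝ) (X : β → Prop) : ℝ := expect w fun b => if X b then 1 else 0

theorem chance_eq {β : Type*} [Fintype β] (w : β → ℝ) (X : β → Prop) [DecidablePred X] :
    chance w X = expect w fun b => if X b then 1 else 0 := by
  unfold chance
  congr!

open Classical in
theorem expect_not {w : β → ℝ} (hw : ∑ b, w b = 1) (X : β → Prop) :
    expect w (fun b => if X b then (0 : ℝ) else 1) = 1 - chance w X := by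
  rw [chance, ← expect_const hw 1, ← expect_sub]
  refine congrArg _ (funext fun b => ?_)
  split_ifs <;> simp [expect, hw]

theorem chance_hits_eq_zero {w : β → ℝ} (hw : ∑ b, w b = 1) (X : β → Prop) :
    chance (piWeight w) (fun x : ι → β => hits X x = 0) =
      (1 - chance w X) ^ Fintype.card ι := by
  classical
  have := expect_piWeight_prod (ι := ι) w fun _ b => if X b then (0 : ℝ) else 1
  rw [Finset.prod_congr rfl fun i _ => expect_not hw X, Finset.prod_const, Finset.card_univ] at this
  rw [← this, chance]
  refine congrArg _ (funext fun x => ?_)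
  split_ifs with h
  · rw [hits_eq_zero_iff] at h
    exact (Finset.prod_eq_one fun i _ => if_neg (h i)).symm
  · rw [hits_eq_zero_iff] at h
    push Not at h
    obtain ⟨i, hX⟩ := h
    symm
    refine Finset.prod_eq_zero (Finset.mem_univ i) ?_
    exact if_pos hX

theorem chance_hits_eq_one {w : β → ℝ} (hw : ∑ b, w b = 1) (X : β → Prop) :
    chance (piWeight w) (fun x : ι → β => hits X x = 1) =
      Fintype.card ι * chance w X * (1 - chance w X) ^ (Fintype.card ι - 1) := by
  classical
  -- For fixed `i` the product of these indicators says that `i` is the only hit, so the event of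
  -- exactly one hit is a sum of product functions.
  have hone : ∀ (x : ι → β) (i : ι),
      (∏ j, if j = i then (if X (x j) then (1 : ℝ) else 0) else if X (x j) then 0 else 1) =
        if (Finset.univ.filter fun j => X (x j)) = {i} then 1 else 0 := by
    intro x i
    split_ifs with h
    · refine Finset.prod_eq_one fun j _ => ?_
      have hj : X (x j) ↔ j = i := by
        have := Finset.ext_iff.mp h j
        simpa using this
      by_cases e : j = i
      · rw [if_pos e, if_pos (hj.mpr e)]
      · rw [if_neg e, if_neg fun h' => e (hj.mp h')]
    · have : ∃ j, ¬ (X (x j) ↔ j = i) := by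
        by_contra hno
        push Not at hno
        exact h (Finset.ext fun j => by simpa using hno j)
      obtain ⟨j, hj⟩ := this
      refine Finset.prod_eq_zero (Finset.mem_univ j) ?_
      by_cases e : j = i
      · rw [if_pos e, if_neg fun h' => hj ⟨fun _ => e, fun _ => h'⟩]
      · rw [if_neg e, if_pos]
        by_contra h'
        exact hj ⟨fun h'' => absurd h'' h', fun e' => absurd e' e⟩
  have hsum : ∀ x : ι → β, (if hits X x = 1 then (1 : ℝ) else 0) = ∑ i, ∏ j,
      if j = i then (if X (x j) then (1 : ℝ) else 0) else if X (x j) then 0 else 1 := by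
    intro x
    simp only [hone]
    split_ifs with h
    · obtain ⟨a, ha⟩ := Finset.card_eq_one.mp h
      simp [ha]
    · refine (Finset.sum_eq_zero fun i _ => if_neg fun e => h ?_).symm
      rw [hits, e, Finset.card_singleton]
  have hterm : ∀ i : ι, expect (piWeight w) (fun x : ι → β => ∏ j,
      if j = i then (if X (x j) then (1 : ℝ) else 0) else if X (x j) then 0 else 1) =
      chance w X * (1 - chance w X) ^ (Fintype.card ι - 1) := by
    intro i
    have := expect_piWeight_prod (ι := ι) w fun j b =>
      if j = i then (if X b then (1 : ℝ) else 0) else if X b then 0 else 1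
    rw [this, ← Finset.mul_prod_erase _ _ (Finset.mem_univ i)]
    congr 1
    · simp only [if_true]
      rfl
    · rw [Finset.prod_congr rfl (g := fun _ => 1 - chance w X), Finset.prod_const,
        Finset.card_erase_of_mem (Finset.mem_univ i), Finset.card_univ]
      intro j hj
      simp only [if_neg (Finset.ne_of_mem_erase hj)]
      exact expect_not hw X
  rw [chance_eq]
  simp only [hsum]
  rw [expect_sum, Finset.sum_congr rfl fun i _ => hterm i, Finset.sum_const, Finset.card_univ,
    nsmul_eq_mul, mul_assoc]

theorem expect_hits {w : β → ℝ} (hw : ∑ b, w b = 1) (X : β → Prop) :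
    expect (piWeight w) (fun x : ι → β => (hits X x : ℝ)) = Fintype.card ι * chance w X := by
  classical
  simp only [hits_eq_sum]
  rw [expect_sum, Finset.sum_congr rfl fun i _ =>
    expect_piWeight_eval hw i fun b => if X b then (1 : ℝ) else 0, Finset.sum_const,
    Finset.card_univ, nsmul_eq_mul]
  rfl

theorem expect_hits_factorial_le {w : β → ℝ} (hw0 : ∀ b, 0 ≤ w b) (hw : ∑ b, w b = 1)
    (X : β → Prop) :
    expect (piWeight w) (fun x : ι → β => (hits X x : ℝ) * ((hits X x : ℝ) - 1)) ≤
      (Fintype.card ι * chance w X) ^ 2 := by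
  classical
  simp only [hits_eq_sum]
  refine (expect_piWeight_factorial_le hw0 hw (f := fun _ b => if X b then (1 : ℝ) else 0)
    fun _ b => by split_ifs <;> norm_num).trans_eq ?_
  rw [Finset.sum_const, Finset.sum_const, Finset.card_univ, nsmul_eq_mul, nsmul_eq_mul]
  have : expect w (fun b => (if X b then (1 : ℝ) else 0) * ((if X b then (1 : ℝ) else 0) - 1)) =
      0 := by
    refine Finset.sum_eq_zero fun b _ => ?_
    by_cases h : X b <;> simp [h]
  rw [this, mul_zero, zero_add]
  rfl

open Classical in
theorem expect_two_le_hits {w : β → ℝ} (hw : ∑ b, w b = 1) (X : β → Prop) :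
    expect (piWeight w) (fun x : ι → β => if 2 ≤ hits X x then (1 : ℝ) else 0) =
      1 - (1 - chance w X) ^ Fintype.card ι -
        Fintype.card ι * chance w X * (1 - chance w X) ^ (Fintype.card ι - 1) := by
  rw [← chance_hits_eq_zero hw X, ← chance_hits_eq_one hw X, chance, chance,
    ← expect_const (sum_piWeight (ι := ι) hw) 1, ← expect_sub, ← expect_sub]
  refine congrArg _ (funext fun x => ?_)
  rw [expect_const (sum_piWeight (ι := ι) hw)]
  rcases Nat.lt_or_ge (hits X x) 2 with h | h
  · interval_cases hits X x <;> norm_num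
  · rw [if_pos h, if_neg (by omega), if_neg (by omega)]
    norm_num

/-- Starting from the full mean, one hit is subtracted exactly and truncation is paid for by h ≤
h(h-1)/M for h > M, so the second factorial moment controls the loss. -/
theorem expect_min_hits_ge {w : β → ℝ} (hw0 : ∀ b, 0 ≤ w b) (hw : ∑ b, w b = 1) (X : β → Prop)
    {M : ℕ} (hM : 0 < M) :
    Fintype.card ι * chance w X -
        Fintype.card ι * chance w X * (1 - chance w X) ^ (Fintype.card ι - 1) -
        (Fintype.card ι * chance w X) ^ 2 / M ≤
      expect (piWeight w)
        (fun x : ι → β => if 2 ≤ hits X x then ((min M (hits X x) : ℕ) : ℝ) else 0) := by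
  classical
  have hM0 : (0 : ℝ) < M := by exact_mod_cast hM
  have h1 : (Fintype.card ι * chance w X) ^ 2 / M ≥ (1 / M : ℝ) *
      expect (piWeight w) (fun x : ι → β => (hits X x : ℝ) * ((hits X x : ℝ) - 1)) := by
    have := expect_hits_factorial_le (ι := ι) hw0 hw X
    rw [ge_iff_le, one_div, inv_mul_eq_div]
    gcongr
  refine le_trans (sub_le_sub_left h1 _) ?_
  rw [← chance_hits_eq_one hw X, ← expect_hits hw X, chance, ← expect_sub, ← expect_const_mul,
    ← expect_sub]
  refine expect_mono (piWeight_nonneg hw0) fun x => ?_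
  rcases Nat.lt_or_ge (hits X x) 2 with h | h
  · interval_cases hits X x <;> norm_num
  · rw [if_pos h, if_neg (by omega)]
    have hr : (2 : ℝ) ≤ hits X x := by exact_mod_cast h
    rcases Nat.lt_or_ge M (hits X x) with hlt | hge
    · have hr' : (M : ℝ) + 1 ≤ hits X x := by exact_mod_cast hlt
      have h3 : (hits X x : ℝ) ≤ 1 / M * (hits X x * (hits X x - 1)) := by
        rw [one_div, inv_mul_eq_div, le_div_iff₀ hM0]
        gcongr
        linarith
      have : (0 : ℝ) ≤ ((min M (hits X x) : ℕ) : ℝ) := Nat.cast_nonneg _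
      linarith
    · rw [min_eq_right hge]
      have : (0 : ℝ) ≤ 1 / M * (hits X x * (hits X x - 1)) :=
        mul_nonneg (by positivity) (mul_nonneg (by linarith) (by linarith))
      linarith

end Binomial

/-! ### Poisson limits for the random tree -/

section Limits

/-- The `d`-face recorded by `o` is not collapsed from below. -/
def Alive {V : Type} {d m : ℕ} (o : Option (Fin d → Cluster V d m)) : Prop :=
  ∃ f, o = some f ∧ ∀ i, ¬ Cluster.Dead (f i)

theorem Cluster.dead_succ_iff {V : Type} [Fintype V] {d m : ℕ} (C : Cluster V d (m + 1)) :
    C.Dead ↔ hits Alive C = 0 := by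
  refine Iff.trans ?_ (hits_eq_zero_iff Alive C).symm
  constructor
  · rintro h v ⟨f, hf, hd⟩
    obtain ⟨i, hi⟩ := h v f hf
    exact hd i hi
  · intro h v f hf
    by_contra hno
    exact h v ⟨f, hf, fun i hi => hno ⟨i, hi⟩⟩

/-- The probability that the root of a random tree is collapsed from below. -/
noncomputable def deadChance (d n : ℕ) (p : ℝ) (m : ℕ) : ℝ :=
  chance (Cluster.weight (V := Fin n) (d := d) p m) Cluster.Dead

/-- The probability that a given `d`-face at the root is present and not collapsed from below. -/
noncomputable def aliveChance (d n : ℕ) (p : ℝ) (m : ℕ) : ℝ :=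
  chance (optWeight p (Cluster.weight (V := Fin n) (d := d) p m)) Alive

theorem deadChance_zero (d n : ℕ) (p : ℝ) : deadChance d n p 0 = 0 := by
  unfold deadChance chance expect
  refine Finset.sum_eq_zero fun C _ => ?_
  exact mul_eq_zero_of_right _ (if_neg fun h => h)

theorem deadChance_succ (d n : ℕ) (p : ℝ) (m : ℕ) :
    deadChance d n p (m + 1) = (1 - aliveChance d n p m) ^ n := by
  have := chance_hits_eq_zero (ι := Fin n)
    (sum_optWeight (ι := Fin d) p (Cluster.sum_weight (V := Fin n) (d := d) p m)) Alive
  rw [Fintype.card_fin] at this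
  rw [aliveChance, ← this, deadChance]
  congr 1
  funext C
  exact propext (Cluster.dead_succ_iff C)

theorem aliveChance_eq (d n : ℕ) (p : ℝ) (m : ℕ) :
    aliveChance d n p m = p * (1 - deadChance d n p m) ^ d := by
  classical
  have hw := Cluster.sum_weight (V := Fin n) (d := d) p m
  have h1 := expect_piWeight_prod (ι := Fin d) (Cluster.weight (V := Fin n) (d := d) p m)
    fun _ C => if C.Dead then (0 : ℝ) else 1
  rw [Finset.prod_congr rfl fun i _ => expect_not hw Cluster.Dead, Finset.prod_const,
    Finset.card_univ, Fintype.card_fin] at h1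
  rw [aliveChance, chance, expect_optWeight, if_neg, mul_zero, zero_add, deadChance, ← h1]
  · congr 2
    funext f
    by_cases h : ∀ i, ¬ (f i).Dead
    · rw [if_pos ⟨f, rfl, h⟩]
      exact (Finset.prod_eq_one fun i _ => if_neg (h i)).symm
    · rw [if_neg]
      · push Not at h
        obtain ⟨i, hi⟩ := h
        symm
        refine Finset.prod_eq_zero (Finset.mem_univ i) ?_
        exact if_pos hi
      · rintro ⟨f', e, hf'⟩
        obtain rfl := Option.some_inj.mp e
        exact h hf'
  · rintro ⟨f, e, -⟩
    cases e

open Classical in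
theorem expect_two_le_aliveCount (d n : ℕ) (p : ℝ) (m : ℕ) :
    expect (Cluster.weight (V := Fin n) (d := d) p (m + 1))
      (fun C => if 2 ≤ C.aliveCount then (1 : ℝ) else 0) =
    1 - (1 - aliveChance d n p m) ^ n -
      n * aliveChance d n p m * (1 - aliveChance d n p m) ^ (n - 1) := by
  have := expect_two_le_hits (ι := Fin n)
    (sum_optWeight (ι := Fin d) p (Cluster.sum_weight (V := Fin n) (d := d) p m)) Alive
  rw [Fintype.card_fin] at this
  exact this

theorem expect_min_aliveCount_ge (d n : ℕ) {p : ℝ} (hp0 : 0 ≤ p) (hp1 : p ≤ 1) (m : ℕ) {M : ℕ}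
    (hM : 0 < M) :
    n * aliveChance d n p m -
        n * aliveChance d n p m * (1 - aliveChance d n p m) ^ (n - 1) -
        (n * aliveChance d n p m) ^ 2 / M ≤
    expect (Cluster.weight (V := Fin n) (d := d) p (m + 1))
      (fun C => if 2 ≤ C.aliveCount then ((min M C.aliveCount : ℕ) : ℝ) else 0) := by
  have := expect_min_hits_ge (ι := Fin n)
    (optWeight_nonneg (ι := Fin d) hp0 hp1
      (Cluster.weight_nonneg (V := Fin n) (d := d) hp0 hp1 m))
    (sum_optWeight (ι := Fin d) p (Cluster.sum_weight (V := Fin n) (d := d) p m)) Alive hM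
  rw [Fintype.card_fin] at this
  exact this

variable {p : ℕ → ℝ} {c : ℝ}

/-- The root is dead with probability (1 - q)^n, where n q tends to c x^d and x is the limiting
probability that a child is not dead. The limit exp(-c x^d) reproduces the recursion of `survival`.
-/
theorem tendsto_chances {d : ℕ} (hp : Tendsto (fun n : ℕ => n * p n) atTop (𝓝 c)) (m : ℕ) :
    Tendsto (fun n => deadChance d n (p n) m) atTop (𝓝 (1 - survival d c m)) ∧
    Tendsto (fun n : ℕ => n * aliveChance d n (p n) m) atTop (𝓝 (c * survival d c m ^ d)) := by
  have step : ∀ m, Tendsto (fun n => deadChance d n (p n) m) atTop (𝓝 (1 - survival d c m)) →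
      Tendsto (fun n : ℕ => n * aliveChance d n (p n) m) atTop
        (𝓝 (c * survival d c m ^ d)) := by
    intro m h
    simp only [aliveChance_eq, ← mul_assoc]
    have h1 := hp.mul ((h.const_sub 1).pow d)
    rwa [sub_sub_cancel] at h1
  induction m with
  | zero =>
    have h0 : Tendsto (fun n => deadChance d n (p n) 0) atTop (𝓝 (1 - survival d c 0)) := by
      simp only [deadChance_zero, survival, sub_self]
      exact tendsto_const_nhds
    exact ⟨h0, step 0 h0⟩
  | succ m ih =>
    have h0 : Tendsto (fun n => deadChance d n (p n) (m + 1)) atTop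
        (𝓝 (1 - survival d c (m + 1))) := by
      simp only [deadChance_succ, survival, sub_sub_cancel]
      have hneg : Tendsto (fun n : ℕ => n * (-aliveChance d n (p n) m)) atTop
          (𝓝 (-(c * survival d c m ^ d))) := by
        simpa only [mul_neg] using ih.2.neg
      simpa only [← sub_eq_add_neg] using Real.tendsto_one_add_pow_exp_of_tendsto hneg
    exact ⟨h0, step _ h0⟩

theorem tendsto_one_sub_pow {q : ℕ → ℝ} {l : ℝ} (hq : Tendsto (fun n : ℕ => n * q n) atTop (𝓝 l)) :
    Tendsto (fun n => (1 - q n) ^ n) atTop (𝓝 (Real.exp (-l))) ∧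
      Tendsto (fun n => (1 - q n) ^ (n - 1)) atTop (𝓝 (Real.exp (-l))) := by
  have h1 : Tendsto (fun n => (1 - q n) ^ n) atTop (𝓝 (Real.exp (-l))) := by
    have hneg : Tendsto (fun n : ℕ => n * (-q n)) atTop (𝓝 (-l)) := by
      simpa only [mul_neg] using hq.neg
    simpa only [← sub_eq_add_neg] using Real.tendsto_one_add_pow_exp_of_tendsto hneg
  have h0 : Tendsto q atTop (𝓝 0) := by
    refine (hq.div_atTop tendsto_natCast_atTop_atTop).congr' ?_
    filter_upwards [eventually_gt_atTop 0] with n hn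
    have : (n : ℝ) ≠ 0 := by positivity
    field_simp
  have h2 : Tendsto (fun n => 1 - q n) atTop (𝓝 1) := by simpa using h0.const_sub 1
  refine ⟨h1, ?_⟩
  have h3 := h1.div h2 one_ne_zero
  rw [div_one] at h3
  refine h3.congr' ?_
  filter_upwards [eventually_gt_atTop 0, h2.eventually_ne one_ne_zero] with n hn hne
  rw [Pi.div_apply, div_eq_iff hne, ← pow_succ, Nat.sub_add_cancel hn]

open Classical in
theorem tendsto_expect_two_le {d : ℕ} (hp : Tendsto (fun n : ℕ => n * p n) atTop (𝓝 c)) (m : ℕ)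
    {l : ℝ} (hl : l = c * survival d c m ^ d) :
    Tendsto (fun n => expect (Cluster.weight (V := Fin n) (d := d) (p n) (m + 1))
      fun C => if 2 ≤ C.aliveCount then (1 : ℝ) else 0) atTop
      (𝓝 (1 - Real.exp (-l) - l * Real.exp (-l))) := by
  have hq := (tendsto_chances (d := d) hp m).2
  rw [← hl] at hq
  obtain ⟨h1, h2⟩ := tendsto_one_sub_pow hq
  simp only [expect_two_le_aliveCount]
  exact (h1.const_sub 1).sub (hq.mul h2)

theorem eventually_lt_expect_min {d : ℕ} (hp01 : ∀ n, 0 ≤ p n ∧ p n ≤ 1)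
    (hp : Tendsto (fun n : ℕ => n * p n) atTop (𝓝 c)) (m : ℕ)
    {l : ℝ} (hl : l = c * survival d c m ^ d) {M : ℕ} (hM : 0 < M) {b : ℝ}
    (hb : b < l - l * Real.exp (-l) - l ^ 2 / M) :
    ∀ᶠ n in atTop, b < expect (Cluster.weight (V := Fin n) (d := d) (p n) (m + 1))
      fun C => if 2 ≤ C.aliveCount then ((min M C.aliveCount : ℕ) : ℝ) else 0 := by
  have hq := (tendsto_chances (d := d) hp m).2
  rw [← hl] at hq
  obtain ⟨h1, h2⟩ := tendsto_one_sub_pow hq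
  have h3 := (hq.sub (hq.mul h2)).sub ((hq.pow 2).div_const (M : ℝ))
  filter_upwards [h3.eventually_const_lt hb] with n hn
  exact hn.trans_le (expect_min_aliveCount_ge d n (hp01 n).1 (hp01 n).2 m hM)

end Limits

end RandomComplex

namespace RandomComplex

/-! ### Positive surplus with high probability, and the theorem -/

section Threshold

open ProbabilityTheory MeasureTheory

open Classical in
/-- The truncated local contribution of a `(d-1)`-face to the number of surviving `d`-faces. -/
noncomputable def localFaces {V : Type} [Fintype V] {d m : ℕ} (M : ℕ) (C : Cluster V d (m + 1)) :
    ℝ :=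
  if 2 ≤ C.aliveCount then ((min M C.aliveCount : ℕ) : ℝ) else 0

open Classical in
/-- The local contribution of a `(d-1)`-face to the shadow of the surviving `d`-faces. -/
noncomputable def localShadow {V : Type} [Fintype V] {d m : ℕ} (C : Cluster V d (m + 1)) : ℝ :=
  if 2 ≤ C.aliveCount then 1 else 0

theorem abs_localFaces_le {V : Type} [Fintype V] {d m : ℕ} (M : ℕ) (C : Cluster V d (m + 1)) :
    |localFaces M C| ≤ M := by
  unfold localFaces
  split_ifs
  · rw [abs_of_nonneg (Nat.cast_nonneg _)]
    exact Nat.cast_le.mpr (min_le_left _ _)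
  · simp

theorem abs_localShadow_le {V : Type} [Fintype V] {d m : ℕ} (C : Cluster V d (m + 1)) :
    |localShadow C| ≤ 1 := by
  unfold localShadow
  split_ifs <;> simp

theorem surplus_ge_sum_local (F : Type*) [Field F] {d n k : ℕ} (hd : 0 < d)
    {S : Set (Finset (Fin n))} {R : PreAbstractSimplicialComplex (Fin n)}
    (h : IsResidue d (k + 1) (complexOf d n S) R) {r : Finset (Fin n) → Fin d → Fin n}
    (hr : ∀ τ, τ.card = d → Function.Injective (r τ) ∧ verts (r τ) = τ) (M : ℕ) :
    (∑ τ ∈ Finset.powersetCard d Finset.univ,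
        localFaces M (clusterOf (facesOf d S) (k + 2) (r τ) τ)) / (d + 1) -
      ∑ τ ∈ Finset.powersetCard d Finset.univ,
        localShadow (clusterOf (facesOf d S) (k + 1) (r τ) τ) ≤ (surplus F d R : ℝ) := by
  have hH : ∀ σ ∈ facesOf d S, σ.card = d + 1 := fun σ hσ => hσ.2
  have hs := core_surplus_ge hH k M
  have hcount : ∀ τ ∈ Finset.powersetCard d (Finset.univ : Finset (Fin n)), ∀ m,
      (clusterOf (facesOf d S) (m + 1) (r τ) τ).aliveCount =
        (aliveAbove d (facesOf d S) m τ).ncard := by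
    intro τ hτ m
    obtain ⟨h1, h2⟩ := hr τ (Finset.mem_powersetCard_univ.mp hτ)
    have := aliveCount_clusterOf hH m h1
    rwa [h2] at this
  rw [surplus_residue F hd h]
  push_cast
  refine le_trans (le_of_eq ?_) hs
  rw [Finset.sum_div, ← Finset.sum_sub_distrib]
  refine Finset.sum_congr rfl fun τ hτ => ?_
  rw [localFaces, localShadow, hcount τ hτ, hcount τ hτ]

theorem coe_projIcc_le {c : ℝ} (hc : 0 ≤ c) (n : ℕ) :
    n * (Set.projIcc (0 : ℝ) 1 zero_le_one (c / n) : ℝ) ≤ c := by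
  rcases Nat.eq_zero_or_pos n with rfl | hn
  · simpa using hc
  · have hn0 : (0 : ℝ) < n := by exact_mod_cast hn
    rw [Set.coe_projIcc]
    have : max 0 (min 1 (c / n)) ≤ c / n := max_le (by positivity) (min_le_right _ _)
    rw [le_div_iff₀ hn0] at this
    linarith

theorem tendsto_projIcc {c : ℝ} (hc : 0 ≤ c) :
    Tendsto (fun n : ℕ => n * (Set.projIcc (0 : ℝ) 1 zero_le_one (c / n) : ℝ)) atTop (𝓝 c) := by
  refine tendsto_const_nhds.congr' ?_
  filter_upwards [eventually_gt_atTop 0, eventually_ge_atTop ⌈c⌉₊] with n hn hcn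
  have hn0 : (0 : ℝ) < n := by exact_mod_cast hn
  have h1 : c / n ≤ 1 := by
    rw [div_le_one hn0]
    exact (Nat.le_ceil c).trans (by exact_mod_cast hcn)
  rw [Set.coe_projIcc, min_eq_right h1, max_eq_right (by positivity)]
  field_simp

theorem prob_le_one (d n : ℕ) (p : ℝ) (P : PreAbstractSimplicialComplex (Fin n) → Prop) :
    prob d n p P ≤ 1 := measureReal_le_one

theorem prob_mono {d n : ℕ} {p : ℝ} {P Q : PreAbstractSimplicialComplex (Fin n) → Prop}
    (h : ∀ S, P (complexOf d n S) → Q (complexOf d n S)) : prob d n p P ≤ prob d n p Q :=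
  measureReal_mono (fun S hS => h S hS) (measure_ne_top _ _)

/-- The error budget: expectations are off by less than δ/4 and sums by less than δ/8 per face, so
the two sides together lose less than 3δ/4 < δ. Since D ≥ 1, dividing by it does not enlarge the
error. -/
theorem div_sub_pos_of_near {N A B D δ e₁ e₂ s₁ s₂ : ℝ} (hN : 0 < N) (hD : 1 ≤ D)
    (hδ : δ = A / D - B) (hδ0 : 0 < δ) (h₁ : A - δ / 4 < e₁) (h₂ : e₂ < B + δ / 4)
    (a₁ : -(δ / 8 * N) < s₁ - N * e₁) (a₂ : s₂ - N * e₂ < δ / 8 * N) : 0 < s₁ / D - s₂ := by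
  have hD0 : 0 < D := by linarith
  have m₁ := mul_lt_mul_of_pos_left h₁ hN
  have m₂ := mul_lt_mul_of_pos_left h₂ hN
  have b₁ : N * (A - 3 * δ / 8) / D < s₁ / D := div_lt_div_of_pos_right (by linarith) hD0
  have b₂ : N * (A - 3 * δ / 8) / D = N * (A / D) - N * (3 * δ / 8) / D := by ring
  have b₃ : N * (3 * δ / 8) / D ≤ N * (3 * δ / 8) := div_le_self (by positivity) hD
  have b₄ : A / D = δ + B := by linarith
  rw [b₄] at b₂
  have : 0 < N * δ := by positivity
  linarith

/-- The two local sums concentrate around their tree expectations, whose difference per face stays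
bounded away from zero. The estimate depends on the `d`-faces alone, so it holds for all scanning
orders at once. -/
theorem tendsto_prob_surplus_pos (F : Type*) [Field F] {d : ℕ} (hd : 0 < d) {c : ℝ} (hc : 0 ≤ c)
    (k : ℕ)
    (hpos : 0 < density d (c * survival d c k ^ d) (c * survival d c (k + 1) ^ d)) :
    Tendsto (fun n : ℕ => prob d n (c / n) fun X =>
      ∀ R, IsResidue d (k + 1) X R → 0 < surplus F d R) atTop (𝓝 1) := by
  obtain ⟨l, hl⟩ : ∃ l, l = c * survival d c k ^ d := ⟨_, rfl⟩
  obtain ⟨l', hl'⟩ : ∃ l', l' = c * survival d c (k + 1) ^ d := ⟨_, rfl⟩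
  rw [← hl, ← hl'] at hpos
  set δ := density d l l' with hδ
  have hd1 : (0 : ℝ) < d + 1 := by positivity
  -- The truncation level is fixed before n grows, so that the truncation loss l'²/M stays below
  -- δ/4.
  obtain ⟨M, hM⟩ := exists_nat_gt (l' ^ 2 / (δ / 4))
  have hM0 : (0 : ℝ) < M := lt_of_le_of_lt (by positivity) hM
  have hMpos : 0 < M := by exact_mod_cast hM0
  have hMl : l' ^ 2 / M < δ / 4 := by
    rw [div_lt_iff₀ (by positivity)] at hM
    rw [div_lt_iff₀ hM0]
    linarith
  let p : ℕ → unitInterval := fun n => Set.projIcc (0 : ℝ) 1 zero_le_one (c / n)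
  have hp : Tendsto (fun n : ℕ => n * (p n : ℝ)) atTop (𝓝 c) := tendsto_projIcc hc
  have hfaces := eventually_lt_expect_min (d := d) (p := fun n => (p n : ℝ))
    (fun n => ⟨(p n).2.1, (p n).2.2⟩) hp (k + 1) hl' hMpos
    (b := l' - l' * Real.exp (-l') - δ / 4) (by linarith)
  have hshadow := (tendsto_expect_two_le (d := d) (p := fun n => (p n : ℝ)) hp k
    hl).eventually_lt_const
    (show _ < 1 - Real.exp (-l) - l * Real.exp (-l) + δ / 4 by linarith)
  obtain ⟨Γ₁, -, h₁⟩ := exists_concentration_bound hd hc (k + 2)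
  obtain ⟨Γ₂, -, h₂⟩ := exists_concentration_bound hd hc (k + 1)
  have hlow : Tendsto (fun n : ℕ => 1 - (Γ₁ * (M : ℝ) ^ 2 / (δ / 8) ^ 2 / n +
      Γ₂ * (1 : ℝ) ^ 2 / (δ / 8) ^ 2 / n)) atTop (𝓝 1) := by
    have t₁ := tendsto_const_div_atTop_nhds_zero_nat (Γ₁ * (M : ℝ) ^ 2 / (δ / 8) ^ 2)
    have t₂ := tendsto_const_div_atTop_nhds_zero_nat (Γ₂ * (1 : ℝ) ^ 2 / (δ / 8) ^ 2)
    simpa using (t₁.add t₂).const_sub 1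
  refine tendsto_of_tendsto_of_tendsto_of_le_of_le' hlow tendsto_const_nhds ?_
    (Eventually.of_forall fun n => prob_le_one _ _ _ _)
  filter_upwards [hfaces, hshadow, eventually_gt_atTop 0, eventually_ge_atTop d]
    with n hf hsh hn hdn
  obtain ⟨r, hr⟩ := exists_enumeration (d := d) hn
  have hN : (0 : ℝ) < n.choose d := by exact_mod_cast Nat.choose_pos hdn
  set ν := setBernoulli {σ : Finset (Fin n) | σ.card = d + 1} (p n) with hν
  have c₁ := h₁ n (p n) hdn (coe_projIcc_le hc n) r hr (localFaces M) M (abs_localFaces_le M)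
    (δ / 8) (by positivity)
  have c₂ := h₂ n (p n) hdn (coe_projIcc_le hc n) r hr localShadow 1 abs_localShadow_le
    (δ / 8) (by positivity)
  set e₁ := expect (Cluster.weight (V := Fin n) (d := d) (p n : ℝ) (k + 2)) (localFaces M)
    with he₁
  set e₂ := expect (Cluster.weight (V := Fin n) (d := d) (p n : ℝ) (k + 1)) localShadow with he₂
  have hf' : l' - l' * Real.exp (-l') - δ / 4 < e₁ := hf
  have hsh' : e₂ < 1 - Real.exp (-l) - l * Real.exp (-l) + δ / 4 := hsh
  set B₁ := {S : Set (Finset (Fin n)) | δ / 8 * n.choose d ≤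
    |∑ τ ∈ Finset.powersetCard d Finset.univ,
      localFaces M (clusterOf (facesOf d S) (k + 2) (r τ) τ) - n.choose d * e₁|} with hB₁
  set B₂ := {S : Set (Finset (Fin n)) | δ / 8 * n.choose d ≤
    |∑ τ ∈ Finset.powersetCard d Finset.univ,
      localShadow (clusterOf (facesOf d S) (k + 1) (r τ) τ) - n.choose d * e₂|} with hB₂
  have hcompl : 1 - ν.real (B₁ ∪ B₂) = ν.real (B₁ ∪ B₂)ᶜ :=
    (probReal_compl_eq_one_sub .of_discrete).symm
  have hunion : ν.real (B₁ ∪ B₂) ≤ ν.real B₁ + ν.real B₂ := measureReal_union_le _ _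
  have hsub : ν.real (B₁ ∪ B₂)ᶜ ≤ prob d n (c / n) fun X =>
      ∀ R, IsResidue d (k + 1) X R → 0 < surplus F d R := by
    refine measureReal_mono ?_ (measure_ne_top _ _)
    intro S hS R hR
    simp only [Set.mem_compl_iff, Set.mem_union, not_or, hB₁, hB₂, Set.mem_ofPred_eq,
      not_le] at hS
    have hge := surplus_ge_sum_local F hd hR hr M
    have a₁ := (abs_lt.mp hS.1).1
    have a₂ := (abs_lt.mp hS.2).2
    set s₁ := ∑ τ ∈ Finset.powersetCard d Finset.univ,
      localFaces M (clusterOf (facesOf d S) (k + 2) (r τ) τ) with hs₁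
    set s₂ := ∑ τ ∈ Finset.powersetCard d Finset.univ,
      localShadow (clusterOf (facesOf d S) (k + 1) (r τ) τ) with hs₂
    have hδ' : δ = (l' - l' * Real.exp (-l')) / (d + 1) -
      (1 - Real.exp (-l) - l * Real.exp (-l)) := rfl
    have hreal : (0 : ℝ) < (surplus F d R : ℝ) :=
      (div_sub_pos_of_near hN (by linarith [(Nat.cast_nonneg d : (0 : ℝ) ≤ d)]) hδ' hpos hf' hsh'
        a₁ a₂).trans_le hge
    exact_mod_cast hreal
  linarith

/-- The shadow bound looks one phase back, so `density` at index j governs j + 1 phases and the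
threshold shifts by one. For homology a single residue with positive surplus is enough, and one
always exists. -/
theorem tendsto_prob_of_criticalConst_lt (F : Type*) [Field F] {d : ℕ} (hd : 2 ≤ d) {β c : ℝ}
    (hβ : IsCriticalRoot d β) (hc : criticalConst d β < c) :
    (∃ k₀ : ℕ, ∀ k : ℕ, k₀ ≤ k → Tendsto (fun n : ℕ => prob d n (c / n) fun X =>
      ∀ R, IsResidue d k X R → 0 < surplus F d R) atTop (𝓝 1)) ∧
    Tendsto (fun n : ℕ => prob d n (c / n) fun X => Nontrivial (Homology F X d)) atTop (𝓝 1) := by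
  have hc0 : 0 ≤ c := ((criticalConst_pos hβ).trans hc).le
  obtain ⟨j₀, hj⟩ := eventually_atTop.mp (eventually_density_pos hd hβ hc)
  have hsur : ∀ k : ℕ, j₀ + 1 ≤ k → Tendsto (fun n : ℕ => prob d n (c / n) fun X =>
      ∀ R, IsResidue d k X R → 0 < surplus F d R) atTop (𝓝 1) := by
    intro k hk
    obtain ⟨j, rfl⟩ : ∃ j, k = j + 1 := ⟨k - 1, by omega⟩
    exact tendsto_prob_surplus_pos F (by omega) hc0 j (hj j (by omega))
  refine ⟨⟨j₀ + 1, hsur⟩, ?_⟩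
  refine tendsto_of_tendsto_of_tendsto_of_le_of_le (hsur (j₀ + 1) le_rfl) tendsto_const_nhds
    (fun n => ?_) fun n => prob_le_one _ _ _ _
  refine prob_mono fun S hS => ?_
  obtain ⟨R, hR⟩ := exists_isResidue d (j₀ + 1) (complexOf d n S)
  exact nontrivial_homology_of_surplus_pos F (by omega) hR (hS R hR)

end Threshold

end RandomComplex

theorem theorem2 (F : Type*) [Field F] (d : ℕ) (hd : 2 ≤ d) :
    (∃! β : ℝ, RandomComplex.IsCriticalRoot d β) ∧
    (∀ β : ℝ, RandomComplex.IsCriticalRoot d β →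
      ∀ c : ℝ, RandomComplex.criticalConst d β < c →
        (∃ k₀ : ℕ, ∀ k : ℕ, k₀ ≤ k →
          Tendsto (fun n : ℕ => RandomComplex.prob d n (c / n) (fun X =>
            ∀ R, RandomComplex.IsResidue d k X R → 0 < RandomComplex.surplus F d R))
            atTop (𝓝 1)) ∧
        Tendsto (fun n : ℕ => RandomComplex.prob d n (c / n) (fun X =>
            Nontrivial (RandomComplex.Homology F X d))) atTop (𝓝 1)) ∧
    (∀ (n : ℕ) (S : Set (Finset (Fin n))) (k : ℕ) (R : PreAbstractSimplicialComplex (Fin n)),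
      RandomComplex.IsResidue d k (RandomComplex.complexOf d n S) R →
      0 < RandomComplex.surplus F d R →
      Nontrivial (RandomComplex.Homology F (RandomComplex.complexOf d n S) d)) :=
  ⟨RandomComplex.existsUnique_isCriticalRoot hd,
    fun _ hβ _ hc => RandomComplex.tendsto_prob_of_criticalConst_lt F hd hβ hc,
    fun _ _ _ _ hR hs => RandomComplex.nontrivial_homology_of_surplus_pos F (by omega) hR hs⟩
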